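/- Let $(\mathscr C,\mathbb E,\mathfrak s)$ be an extriangulated category (Nakaoka–Palu), let $\mathbb E^i$ ($i\ge 1$) be its higher positive extensions, i.e. $\mathbb E^1=\mathbb E$ and $\mathbb E^{i+1}(C,A)=\int^{X}\mathbb E(X,A)\otimes_{\mathbb Z}\mathbb E^{i}(C,X)$, and let $d\ge 1$. All subcategories are full and closed under isomorphisms. **Cluster tilting.** A subcategory $\mathcal T$ is $(d+1)$-cluster tilting if * every $X\in\mathscr C$ admits $\mathbb E$-triangles $X\xrightarrow{f}T\to Z\dashrightarrow$ and $Z'\to T'\xrightarrow{g}X\dashrightarrow$ in which $f$ is a left and $g$ a right $\mathcal T$-approximation, and * $\mathcal T=\{X\mid \mathbb E^i(\mathcal T,X)=0,\ 1\le i\le d\}=\{X\mid \mathbb E^i(X,\mathcal T)=0,\ 1\le i\le d\}$. **Grothendieck groups.** For a subcategory $\mathcal X$, $K_0^{\rm sp}(\mathcal X)$ is the free abelian group on the isomorphism classes of objects of $\mathcal X$ modulo the relations $[A\oplus B]=[A]+[B]$ with $A$, $B$ and $A\oplus B$ in $\mathcal X$. The group $K_0(\mathcal X)$ is the quotient of $K_0^{\rm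 sp}(\mathcal X)$ by the elements $[A]-[B]+[C]$ for all $\mathbb E$-triangles $A\to B\to C\dashrightarrow$ with terms in $\mathcal X$. **Indices.** For $t\ge 0$ let $\mathcal T^t$ be the subcategory of those $X$ that admit an $\mathbb E$-triangle sequence $X\to X_0\to\cdots\to X_t\to 0$ with all $X_i\in\mathcal T$, that is, a sequence spliced from $\mathbb E$-triangles $X\to X_0\to K_0\dashrightarrow$, $K_{i}\to X_{i+1}\to K_{i+1}\dashrightarrow$ ($0\le i<t$) with $K_t=0$. For such $X$ put $\operatorname{ind}^L_{\mathcal T}(X)=\sum_{i=0}^t(-1)^i[X_i]\in K_0^{\rm sp}(\mathcal T)$. Dually, $\mathcal T_t$ consists of those $X$ that admit an $\mathbb E$-triangle sequence $0\to Y_t\to\cdots\to Y_0\to X$ with all $Y_i\in\mathcal T$, and $\operatorname{ind}^R_{\mathcal T}(X)=\sum_{i=0}^t(-1)^i[Y_i]$. **Index Grothendieck group.** Let $\Phi$ send the $\mathcal T$-module $\mathbb E(-,X)|_{\mathcal T}$, for $X\in\mathcal T_d\cap\mathcal T^1$, to $\operatorname{ind}^R_{\mathcal T}(X)-\operatorname{ind}^L_{\mathcal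 T}(X)$, and let $\Psi$ send $\mathbb E(X,-)|_{\mathcal T}$, for $X\in\mathcal T^d\cap\mathcal T_1$, to $\operatorname{ind}^L_{\mathcal T}(X)-\operatorname{ind}^R_{\mathcal T}(X)$. Write $\operatorname{im}\Phi$ and $\operatorname{im}\Psi$ for the subgroups of $K_0^{\rm sp}(\mathcal T)$ generated by their values, and put $K_0^{\rm in}(\mathcal T)=K_0^{\rm sp}(\mathcal T)/\operatorname{im}\Phi$. **Relative structures.** Let $\mathbb E_{\mathcal T}(C,A)$ be the subgroup of those $\delta\in\mathbb E(C,A)$ with $f^*\delta=0$ for all $f\colon T\to C$ with $T\in\mathcal T$, and $\mathbb E^{\mathcal T}(C,A)$ the subgroup of those $\delta$ with $g_*\delta=0$ for all $g\colon A\to T$ with $T\in\mathcal T$. The groups $K_0(\mathscr C,\mathbb E_{\mathcal T})$ and $K_0(\mathscr C,\mathbb E^{\mathcal T})$ are the quotients of $K_0^{\rm sp}(\mathscr C)$ by the elements $[A]-[B]+[C]$ for all $\mathbb E$-triangles $A\to B\to C\overset{\delta}{\dashrightarrow}$ with $\delta$ in $\mathbb E_{\mathcal T}(C,A)$, respectively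 in $\mathbb E^{\mathcal T}(C,A)$. **Theorem.** Let $\mathcal T$ and $\mathcal U$ be $(d+1)$-cluster tilting subcategories of $\mathscr C$. In each of the statements below, the objects at which an index is taken have sequences as in its definition (of length $t$ in (2), and of length $d$ in (1), (3), (4)), and the index does not depend on the chosen sequence of that length. 1. If $d=1$ (that is, $\mathcal T$ and $\mathcal U$ are $2$-cluster tilting), then $\operatorname{ind}^R_{\mathcal U}\colon K_0^{\rm sp}(\mathcal T)\to K_0^{\rm sp}(\mathcal U)$ and $\operatorname{ind}^L_{\mathcal T}\colon K_0^{\rm sp}(\mathcal U)\to K_0^{\rm sp}(\mathcal T)$ are mutually inverse group isomorphisms. 2. If $1\le t<d$, then $\operatorname{ind}^L_{\mathcal T}\colon K_0(\mathcal T^t)\to K_0^{\rm sp}(\mathcal T)$ and $\operatorname{ind}^R_{\mathcal T}\colon K_0(\mathcal T_t)\to K_0^{\rm sp}(\mathcal T)$ are group isomorphisms. 3. $\operatorname{im}\Phi=\operatorname{im}\Psi$, and each of $\operatorname{ind}^L_{\mathcal T}$ and $\operatorname{ind}^R_{\mathcal T}$ induces a group isomorphism $K_0(\mathscr C)\to K_0^{\rm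 in}(\mathcal T)$. 4. $\operatorname{ind}^L_{\mathcal T}\colon K_0(\mathscr C,\mathbb E^{\mathcal T})\to K_0^{\rm sp}(\mathcal T)$ and $\operatorname{ind}^R_{\mathcal T}\colon K_0(\mathscr C,\mathbb E_{\mathcal T})\to K_0^{\rm sp}(\mathcal T)$ are group isomorphisms, whose inverses are the homomorphisms $[T]\mapsto[T]$ induced by the inclusion $\mathcal T\subseteq\mathscr C$. -/

import Mathlib

open CategoryTheory CategoryTheory.Limits Opposite

universe w v u

namespace Extri

noncomputable section

/-! ### Bifunctors of extensions -/

section Bifunctor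

variable {C : Type u} [Category.{v} C] (E : Cᵒᵖ ⥤ C ⥤ AddCommGrpCat.{w})

/-- The group `E(Z, A)` of extensions of `Z` by `A`. -/
abbrev Ext (Z A : C) : Type w := (E.obj (op Z)).obj A

/-- `a_* : E(Z, A) → E(Z, A')` for `a : A ⟶ A'`. -/
def push {Z A A' : C} (a : A ⟶ A') : Ext E Z A →+ Ext E Z A' :=
  ((E.obj (op Z)).map a).hom

/-- `c^* : E(Z, A) → E(Z', A)` for `c : Z' ⟶ Z`. -/
def pull {Z Z' A : C} (c : Z' ⟶ Z) : Ext E Z A →+ Ext E Z' A :=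
  ((E.map c.op).app A).hom

lemma push_comp {Z A A' A'' : C} (a : A ⟶ A') (a' : A' ⟶ A'') (δ : Ext E Z A) :
    push E (a ≫ a') δ = push E a' (push E a δ) := by
  simp [push]

lemma push_id {Z A : C} (δ : Ext E Z A) : push E (𝟙 A) δ = δ := by
  simp [push]

lemma pull_push {Z Z' A A' : C} (c : Z' ⟶ Z) (a : A ⟶ A') (δ : Ext E Z A) :
    pull E c (push E a δ) = push E a (pull E c δ) :=
  ConcreteCategory.congr_hom ((E.map c.op).naturality a) δ

/-! ### Higher positive extensions

`E^{n+1}(Z, A)` is the coend `∫^X E(X, A) ⊗ E^n(Z, X)`, given by generators and relations. -/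

variable (G : C ⥤ AddCommGrpCat.{max u v w})

/-- Generators `δ ⊗ g` of `∫^X E(X, A) ⊗ G(X)`, with `δ ∈ E(X, A)` and `g ∈ G(X)`. -/
abbrev TensorGen (A : C) : Type (max u v w) := Σ X : C, Ext E X A × G.obj X

/-- The relations of the coend: biadditivity of `δ ⊗ g`, and `(f^* δ) ⊗ g = δ ⊗ (f_* g)`. -/
inductive TensorRel (A : C) : FreeAbelianGroup (TensorGen E G A) → Prop
  | add_left (X : C) (δ δ' : Ext E X A) (g : G.obj X) : TensorRel A
      (FreeAbelianGroup.of ⟨X, δ + δ', g⟩ - FreeAbelianGroup.of ⟨X, δ, g⟩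
        - FreeAbelianGroup.of ⟨X, δ', g⟩)
  | add_right (X : C) (δ : Ext E X A) (g g' : G.obj X) : TensorRel A
      (FreeAbelianGroup.of ⟨X, δ, g + g'⟩ - FreeAbelianGroup.of ⟨X, δ, g⟩
        - FreeAbelianGroup.of ⟨X, δ, g'⟩)
  | balanced (X Y : C) (f : X ⟶ Y) (δ : Ext E Y A) (g : G.obj X) : TensorRel A
      (FreeAbelianGroup.of ⟨X, pull E f δ, g⟩ - FreeAbelianGroup.of ⟨Y, δ, (G.map f).hom g⟩)

/-- The subgroup generated by the relations of the coend. -/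
def tensorRelations (A : C) : AddSubgroup (FreeAbelianGroup (TensorGen E G A)) :=
  AddSubgroup.closure {r | TensorRel E G A r}

/-- The map on generators induced by `a : A ⟶ A'`. -/
def tensorGenMap {A A' : C} (a : A ⟶ A') (p : TensorGen E G A) : TensorGen E G A' :=
  ⟨p.1, push E a p.2.1, p.2.2⟩

lemma tensorRelations_le {A A' : C} (a : A ⟶ A') :
    tensorRelations E G A ≤
      (tensorRelations E G A').comap (FreeAbelianGroup.map (tensorGenMap E G a)) := by
  refine (AddSubgroup.closure_le _).2 ?_
  rintro r (⟨X, δ, δ', g⟩ | ⟨X, δ, g, g'⟩ | ⟨X, Y, f, δ, g⟩) <;>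
    refine AddSubgroup.subset_closure ?_ <;>
    simp only [map_sub, FreeAbelianGroup.map_of_apply, tensorGenMap, map_add]
  · exact TensorRel.add_left X _ _ g
  · exact TensorRel.add_right X _ g g'
  · rw [← pull_push]
    exact TensorRel.balanced X Y f _ g

/-- The functor `A ↦ ∫^X E(X, A) ⊗ G(X)`. -/
def tensor : C ⥤ AddCommGrpCat.{max u v w} where
  obj A := AddCommGrpCat.of (FreeAbelianGroup (TensorGen E G A) ⧸ tensorRelations E G A)
  map a := AddCommGrpCat.ofHom (QuotientAddGroup.map _ _
    (FreeAbelianGroup.map (tensorGenMap E G a)) (tensorRelations_le E G a))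
  map_id A := by
    ext p
    simp [tensorGenMap, push_id]
  map_comp a a' := by
    ext p
    simp [tensorGenMap, push_comp]

/-- The higher positive extensions: `higherExt E n Z` is the functor `E^{n+1}(Z, -)`, so that
`higherExt E 0 Z` is `E(Z, -)` (in a larger universe). -/
def higherExt : ℕ → C → (C ⥤ AddCommGrpCat.{max u v w})
  | 0, Z => E.obj (op Z) ⋙ AddCommGrpCat.uliftFunctor.{max u v, w}
  | n + 1, Z => tensor E (higherExt n Z)

/-- `E^i(Z, A) = 0` for all `1 ≤ i ≤ n`. -/
def ExtVanish (n : ℕ) (Z A : C) : Prop :=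
  ∀ i, 1 ≤ i → i ≤ n → Subsingleton ((higherExt E (i - 1) Z).obj A)

end Bifunctor

end

/-! ### Split Grothendieck groups -/

noncomputable section

variable {C : Type u} [Category.{v} C]

/-- The set of isomorphism classes of the objects of the full subcategory `P`. -/
abbrev IsoClass (P : ObjectProperty C) : Type u :=
  Quotient (isIsomorphicSetoid P.FullSubcategory)

/-- The generator of an object of `P` in the free abelian group on isomorphism classes. -/
def isoClassOf {P : ObjectProperty C} (X : C) (hX : P X) : FreeAbelianGroup (IsoClass P) :=
  FreeAbelianGroup.of (Quotient.mk (isIsomorphicSetoid P.FullSubcategory) ⟨X, hX⟩)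

variable [Preadditive C] [HasBinaryBiproducts C]

/-- The relations `[A ⊕ B] - [A] - [B]` with `A`, `B`, `A ⊕ B` in `P`. -/
def splitRelations (P : ObjectProperty C) : AddSubgroup (FreeAbelianGroup (IsoClass P)) :=
  AddSubgroup.closure {r | ∃ (A B : C) (hA : P A) (hB : P B) (hAB : P (A ⊞ B)),
    r = isoClassOf (A ⊞ B) hAB - isoClassOf A hA - isoClassOf B hB}

/-- The split Grothendieck group of the full subcategory `P`. -/
abbrev K0sp (P : ObjectProperty C) : Type u :=
  FreeAbelianGroup (IsoClass P) ⧸ splitRelations P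

/-- The class of an object of `P` in the split Grothendieck group. -/
def splitClass {P : ObjectProperty C} (X : C) (hX : P X) : K0sp P :=
  QuotientAddGroup.mk (isoClassOf X hX)

end

/-! ### Extriangulated categories -/

/-- The structure of an extriangulated category (in the sense of Nakaoka and Palu) on an additive
category: an additive bifunctor `E` with an additive realization satisfying the axioms (ET3),
(ET3)ᵒᵖ, (ET4) and (ET4)ᵒᵖ. The realization `𝔰`, which sends `δ ∈ E(Z, A)` to an equivalence class
of sequences `A ⟶ B ⟶ Z`, is given by the relation `IsTriangle x y δ`, i.e. `𝔰(δ) = [x, y]`. -/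
structure ExtriangulatedStructure (C : Type u) [Category.{v} C] [Preadditive C]
    [HasZeroObject C] [HasBinaryBiproducts C] where
  /-- the bifunctor of extensions -/
  E : Cᵒᵖ ⥤ C ⥤ AddCommGrpCat.{w}
  additive_left : E.Additive
  additive_right : ∀ Z, (E.obj Z).Additive
  /-- `A ⟶ B ⟶ Z` together with `δ` is an `E`-triangle -/
  IsTriangle : ∀ {A B Z : C}, (A ⟶ B) → (B ⟶ Z) → Ext E Z A → Prop
  exists_triangle : ∀ {A Z : C} (δ : Ext E Z A), ∃ (B : C) (x : A ⟶ B) (y : B ⟶ Z),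
    IsTriangle x y δ
  isTriangle_iff : ∀ {A B B' Z : C} {x : A ⟶ B} {y : B ⟶ Z} {δ : Ext E Z A},
    IsTriangle x y δ → ∀ (x' : A ⟶ B') (y' : B' ⟶ Z),
      (IsTriangle x' y' δ ↔ ∃ b : B ≅ B', x ≫ b.hom = x' ∧ b.hom ≫ y' = y)
  /-- a morphism of extensions is realized by a morphism of sequences -/
  exists_hom : ∀ {A B Z A' B' Z' : C} {x : A ⟶ B} {y : B ⟶ Z} {δ : Ext E Z A}
    {x' : A' ⟶ B'} {y' : B' ⟶ Z'} {δ' : Ext E Z' A'},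
    IsTriangle x y δ → IsTriangle x' y' δ' → ∀ (a : A ⟶ A') (c : Z ⟶ Z'),
      push E a δ = pull E c δ' → ∃ b : B ⟶ B', x ≫ b = a ≫ x' ∧ y ≫ c = b ≫ y'
  /-- the zero extension is realized by the split sequence -/
  isTriangle_zero : ∀ A Z : C,
    IsTriangle (biprod.inl : A ⟶ A ⊞ Z) (biprod.snd : A ⊞ Z ⟶ Z) (0 : Ext E Z A)
  /-- the direct sum of two extensions is realized by the direct sum of the sequences -/
  isTriangle_biprod : ∀ {A B Z A' B' Z' : C} {x : A ⟶ B} {y : B ⟶ Z} {δ : Ext E Z A}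
    {x' : A' ⟶ B'} {y' : B' ⟶ Z'} {δ' : Ext E Z' A'},
    IsTriangle x y δ → IsTriangle x' y' δ' →
      IsTriangle (biprod.map x x') (biprod.map y y')
        (pull E biprod.fst (push E biprod.inl δ) + pull E biprod.snd (push E biprod.inr δ') :
          Ext E (Z ⊞ Z') (A ⊞ A'))
  et3 : ∀ {A B Z A' B' Z' : C} {x : A ⟶ B} {y : B ⟶ Z} {δ : Ext E Z A}
    {x' : A' ⟶ B'} {y' : B' ⟶ Z'} {δ' : Ext E Z' A'},
    IsTriangle x y δ → IsTriangle x' y' δ' → ∀ (a : A ⟶ A') (b : B ⟶ B'), x ≫ b = a ≫ x' →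
      ∃ c : Z ⟶ Z', y ≫ c = b ≫ y' ∧ push E a δ = pull E c δ'
  et3_op : ∀ {A B Z A' B' Z' : C} {x : A ⟶ B} {y : B ⟶ Z} {δ : Ext E Z A}
    {x' : A' ⟶ B'} {y' : B' ⟶ Z'} {δ' : Ext E Z' A'},
    IsTriangle x y δ → IsTriangle x' y' δ' → ∀ (b : B ⟶ B') (c : Z ⟶ Z'), y ≫ c = b ≫ y' →
      ∃ a : A ⟶ A', x ≫ b = a ≫ x' ∧ push E a δ = pull E c δ'
  et4 : ∀ {A B D Z F : C} {f : A ⟶ B} {f' : B ⟶ D} {δ : Ext E D A}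
    {g : B ⟶ Z} {g' : Z ⟶ F} {δ' : Ext E F B},
    IsTriangle f f' δ → IsTriangle g g' δ' →
      ∃ (K : C) (h' : Z ⟶ K) (δ'' : Ext E K A) (d : D ⟶ K) (e : K ⟶ F),
        IsTriangle (f ≫ g) h' δ'' ∧ f' ≫ d = g ≫ h' ∧ h' ≫ e = g' ∧
        IsTriangle d e (push E f' δ') ∧ pull E d δ'' = δ ∧ push E f δ'' = pull E e δ'
  et4_op : ∀ {D A B F Z : C} {f' : D ⟶ A} {f : A ⟶ B} {δ : Ext E B D}
    {g' : F ⟶ B} {g : B ⟶ Z} {δ' : Ext E Z F},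
    IsTriangle f' f δ → IsTriangle g' g δ' →
      ∃ (K : C) (h' : K ⟶ A) (δ'' : Ext E Z K) (d : D ⟶ K) (e : K ⟶ F),
        IsTriangle h' (f ≫ g) δ'' ∧ d ≫ h' = f' ∧ h' ≫ f = e ≫ g' ∧
        IsTriangle d e (pull E g' δ) ∧ push E e δ'' = δ' ∧ push E d δ = pull E g δ''

namespace ExtriangulatedStructure

noncomputable section

variable {C : Type u} [Category.{v} C] [Preadditive C] [HasZeroObject C] [HasBinaryBiproducts C]
  (S : ExtriangulatedStructure.{w} C)

/-! ### Cluster tilting subcategories -/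

/-- `T^{⊥_[1,n]}`: the objects `X` with `E^i(T, X) = 0` for `1 ≤ i ≤ n`. -/
def rightPerp (T : ObjectProperty C) (n : ℕ) : ObjectProperty C :=
  fun X => ∀ M, T M → ExtVanish S.E n M X

/-- `^{⊥_[1,n]}T`: the objects `X` with `E^i(X, T) = 0` for `1 ≤ i ≤ n`. -/
def leftPerp (T : ObjectProperty C) (n : ℕ) : ObjectProperty C :=
  fun X => ∀ M, T M → ExtVanish S.E n X M

/-- `T` is strongly functorially finite: each object `X` has `E`-triangles `X ⟶ M ⟶ Z` and
`Z' ⟶ M' ⟶ X` in which `X ⟶ M` is a left and `M' ⟶ X` is a right `T`-approximation. -/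
structure IsStronglyFunctoriallyFinite (T : ObjectProperty C) : Prop where
  left : ∀ X : C, ∃ (M Z : C) (f : X ⟶ M) (g : M ⟶ Z) (δ : Ext S.E Z X),
    S.IsTriangle f g δ ∧ T M ∧ ∀ (M' : C) (k : X ⟶ M'), T M' → ∃ l : M ⟶ M', f ≫ l = k
  right : ∀ X : C, ∃ (Z M : C) (f : Z ⟶ M) (g : M ⟶ X) (δ : Ext S.E X Z),
    S.IsTriangle f g δ ∧ T M ∧ ∀ (M' : C) (k : M' ⟶ X), T M' → ∃ l : M' ⟶ M, l ≫ g = k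

/-- `T` is an `n`-cluster tilting subcategory (for `n ≥ 1`): it is strongly functorially finite
and `T = T^{⊥_[1,n-1]} = ^{⊥_[1,n-1]}T`. -/
structure IsClusterTilting (n : ℕ) (T : ObjectProperty C) : Prop where
  stronglyFunctoriallyFinite : S.IsStronglyFunctoriallyFinite T
  eq_rightPerp : T = S.rightPerp T (n - 1)
  eq_leftPerp : T = S.leftPerp T (n - 1)

/-! ### Grothendieck groups -/

/-- A choice of a subgroup of each `E(Z, A)`, for example that of a subfunctor of `E`. -/
abbrev ExtSubgroups : Type (max u w) := ∀ Z A : C, AddSubgroup (Ext S.E Z A)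

/-- The relations `[A] - [B] + [Z]` for the `E`-triangles `A ⟶ B ⟶ Z` with terms in `P` whose
extension class lies in `F(Z, A)`. -/
def triangleRelations (F : S.ExtSubgroups) (P : ObjectProperty C) : AddSubgroup (K0sp P) :=
  AddSubgroup.closure {r | ∃ (A B Z : C) (x : A ⟶ B) (y : B ⟶ Z) (δ : Ext S.E Z A)
    (hA : P A) (hB : P B) (hZ : P Z), S.IsTriangle x y δ ∧ δ ∈ F Z A ∧
      r = splitClass A hA - splitClass B hB + splitClass Z hZ}

/-- The Grothendieck group of `P` with respect to the `E`-triangles with class in `F`. -/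
abbrev K0rel (F : S.ExtSubgroups) (P : ObjectProperty C) : Type u :=
  K0sp P ⧸ S.triangleRelations F P

/-- The class of an object of `P` in the Grothendieck group. -/
def relClass (F : S.ExtSubgroups) {P : ObjectProperty C} (X : C) (hX : P X) : S.K0rel F P :=
  QuotientAddGroup.mk (splitClass X hX)

/-- All extensions. -/
def allExt : S.ExtSubgroups := fun _ _ => ⊤

/-- The subfunctor `E_T`: the `δ ∈ E(Z, A)` with `f^* δ = 0` for all `f : M ⟶ Z` with `M` in
`T`. -/
def lowerExt (T : ObjectProperty C) : S.ExtSubgroups := fun Z A =>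
  { carrier := {δ | ∀ (M : C) (f : M ⟶ Z), T M → pull S.E f δ = 0}
    zero_mem' := fun M f _ => map_zero (pull S.E f)
    add_mem' := fun {a b} ha hb M f hM => by rw [map_add, ha M f hM, hb M f hM, add_zero]
    neg_mem' := fun {a} ha M f hM => by rw [map_neg, ha M f hM, neg_zero] }

/-- The subfunctor `E^T`: the `δ ∈ E(Z, A)` with `g_* δ = 0` for all `g : A ⟶ M` with `M` in
`T`. -/
def upperExt (T : ObjectProperty C) : S.ExtSubgroups := fun Z A =>
  { carrier := {δ | ∀ (M : C) (g : A ⟶ M), T M → push S.E g δ = 0}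
    zero_mem' := fun M g _ => map_zero (push S.E g)
    add_mem' := fun {a b} ha hb M g hM => by rw [map_add, ha M g hM, hb M g hM, add_zero]
    neg_mem' := fun {a} ha M g hM => by rw [map_neg, ha M g hM, neg_zero] }

/-! ### Filtrations and indices -/

variable (T : ObjectProperty C)

/-- `LeftFiltration T t X`: an `E`-triangle sequence `X ⟶ X₀ ⟶ ⋯ ⟶ X_t ⟶ 0` with all `X_i` in `T`,
spliced from `E`-triangles `X ⟶ X₀ ⟶ K₀`, `K₀ ⟶ X₁ ⟶ K₁`, …, `K_{t-1} ⟶ X_t ⟶ 0`. -/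
inductive LeftFiltration : ℕ → C → Type (max u v w)
  | last {X X₀ K : C} (x : X ⟶ X₀) (y : X₀ ⟶ K) (δ : Ext S.E K X)
      (tri : S.IsTriangle x y δ) (mem : T X₀) (hK : IsZero K) : LeftFiltration 0 X
  | cons {t : ℕ} {X X₀ K : C} (x : X ⟶ X₀) (y : X₀ ⟶ K) (δ : Ext S.E K X)
      (tri : S.IsTriangle x y δ) (mem : T X₀) (tail : LeftFiltration t K) :
      LeftFiltration (t + 1) X

/-- `RightFiltration T t X`: an `E`-triangle sequence `0 ⟶ Y_t ⟶ ⋯ ⟶ Y₀ ⟶ X` with all `Y_i` in `T`,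
spliced from `E`-triangles `P₀ ⟶ Y₀ ⟶ X`, `P₁ ⟶ Y₁ ⟶ P₀`, …, `0 ⟶ Y_t ⟶ P_{t-1}`. -/
inductive RightFiltration : ℕ → C → Type (max u v w)
  | last {X Y₀ K : C} (x : K ⟶ Y₀) (y : Y₀ ⟶ X) (δ : Ext S.E X K)
      (tri : S.IsTriangle x y δ) (mem : T Y₀) (hK : IsZero K) : RightFiltration 0 X
  | cons {t : ℕ} {X Y₀ K : C} (x : K ⟶ Y₀) (y : Y₀ ⟶ X) (δ : Ext S.E X K)
      (tri : S.IsTriangle x y δ) (mem : T Y₀) (tail : RightFiltration t K) :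
      RightFiltration (t + 1) X

variable {S T}

/-- The alternating sum `[X₀] - [X₁] + ⋯ + (-1)^t [X_t]` of a left filtration. -/
def LeftFiltration.altSum : {t : ℕ} → {X : C} → S.LeftFiltration T t X → K0sp T
  | _, _, .last (X₀ := X₀) _ _ _ _ mem _ => splitClass X₀ mem
  | _, _, .cons (X₀ := X₀) _ _ _ _ mem tail => splitClass X₀ mem - tail.altSum

/-- The alternating sum `[Y₀] - [Y₁] + ⋯ + (-1)^t [Y_t]` of a right filtration. -/
def RightFiltration.altSum : {t : ℕ} → {X : C} → S.RightFiltration T t X → K0sp T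
  | _, _, .last (Y₀ := Y₀) _ _ _ _ mem _ => splitClass Y₀ mem
  | _, _, .cons (Y₀ := Y₀) _ _ _ _ mem tail => splitClass Y₀ mem - tail.altSum

variable (S T)

/-- The subcategory `T^t` of the objects that have a left `T`-filtration of length `t`. -/
def upper (t : ℕ) : ObjectProperty C := fun X => Nonempty (S.LeftFiltration T t X)

/-- The subcategory `T_t` of the objects that have a right `T`-filtration of length `t`. -/
def lower (t : ℕ) : ObjectProperty C := fun X => Nonempty (S.RightFiltration T t X)

/-- `g` is the left index of `X`: there are left `T`-filtrations of length `t` of `X`, and `g` is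
the alternating sum of each of them. -/
def IsLeftIndex (t : ℕ) (X : C) (g : K0sp T) : Prop :=
  S.upper T t X ∧ ∀ F : S.LeftFiltration T t X, F.altSum = g

/-- `g` is the right index of `X`: there are right `T`-filtrations of length `t` of `X`, and `g` is
the alternating sum of each of them. -/
def IsRightIndex (t : ℕ) (X : C) (g : K0sp T) : Prop :=
  S.lower T t X ∧ ∀ F : S.RightFiltration T t X, F.altSum = g

/-! ### The index Grothendieck group -/

/-- The right `T`-module `E(-, X)|_T`. -/
def rightModule (X : C) : T.FullSubcategoryᵒᵖ ⥤ AddCommGrpCat.{w} :=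
  T.ι.op ⋙ S.E.flip.obj X

/-- The left `T`-module `E(X, -)|_T`. -/
def leftModule (X : C) : T.FullSubcategory ⥤ AddCommGrpCat.{w} :=
  T.ι ⋙ S.E.obj (op X)

/-- The graph of `Φ`: `E(-, X)|_T ↦ ind^R(X) - ind^L(X)` for `X` in `T_d ∩ T^1`. -/
def PhiGraph (d : ℕ) (M : T.FullSubcategoryᵒᵖ ⥤ AddCommGrpCat.{w}) (g : K0sp T) : Prop :=
  ∃ (X : C) (r l : K0sp T), Nonempty (M ≅ S.rightModule T X) ∧
    S.IsRightIndex T d X r ∧ S.IsLeftIndex T 1 X l ∧ g = r - l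

/-- The graph of `Ψ`: `E(X, -)|_T ↦ ind^L(X) - ind^R(X)` for `X` in `T^d ∩ T_1`. -/
def PsiGraph (d : ℕ) (M : T.FullSubcategory ⥤ AddCommGrpCat.{w}) (g : K0sp T) : Prop :=
  ∃ (X : C) (l r : K0sp T), Nonempty (M ≅ S.leftModule T X) ∧
    S.IsLeftIndex T d X l ∧ S.IsRightIndex T 1 X r ∧ g = l - r

/-- The subgroup generated by the values of `Φ`. -/
def imPhi (d : ℕ) : AddSubgroup (K0sp T) :=
  AddSubgroup.closure {g | ∃ M, S.PhiGraph T d M g}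

/-- The subgroup generated by the values of `Ψ`. -/
def imPsi (d : ℕ) : AddSubgroup (K0sp T) :=
  AddSubgroup.closure {g | ∃ M, S.PsiGraph T d M g}

/-- The index Grothendieck group of `T`. -/
abbrev K0in (d : ℕ) : Type u := K0sp T ⧸ S.imPhi T d

end

end ExtriangulatedStructure

end Extri

/-!
The proof has three layers.

*Extriangles and higher extensions.* The axioms give the six-term exact sequences of an extriangle,
the pullback of two deflations (`IsTriangle.exists_pullback`) and homotopy pullbacks. For an
additive functor `G` that is exact in the middle of extriangles, homotopy pullbacks show that
`δ ⊗ g` vanishes in `∫^X E(X, A) ⊗ G(X)` if and only if `g` comes from some `W ⟶ X` that kills `δ`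
(`IsHalfExact.exists_of_tmul_eq_zero`): one compares the coend with the group of pairs `(δ, g)`
up to spans. Hence `∫^X E(X, -) ⊗ G(X)` continues the exact sequence of `G`, and the long exact
sequence of `E^i(M, -)` follows by induction. The sequence in the other variable is the same
statement for the opposite extriangulated category; that the higher extensions of the two
categories vanish simultaneously is `extVanish_op_iff`, where the iterated coend is rebracketed.

*Indices.* Everything is proved for right filtrations and transported to left filtrations through
the opposite category. Dimension shifting produces right filtrations of length `d` for every
object, and shows that `E^j(T, X) = 0` for `1 ≤ j ≤ d - t` if `X` lies in `T_t`. With this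
vanishing, Schanuel's lemma makes the alternating sums independent of the filtration
(`RightFiltration.value_add_eq`), and the horseshoe lemma makes the right index additive on the
extriangles with class in `E_T` (`IsTriangle.exists_rightFiltration`).

*Grothendieck groups.* A filtration of `X` writes the class of `X` as the image of its index, so the
index is inverse to `[M] ↦ [M]` whenever it is additive on the extriangles in question. For
`t < d` all extriangles in `T_t` have class in `E_T`. For two `2`-cluster tilting subcategories,
the right `U`-filtration of an object `X` of `T` has class in `E^T`, as `E(X, T) = 0`. For the whole
category, right approximations replace any extriangle by one of the form `K ⟶ Y ⟶ Y'` with `Y` and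
`Y'` in `T`, with the same defect of the right index (`IsTriangle.exists_defect_eq`); that defect is
`ind^R(K) - ind^L(K)`, an element of `im Φ`. So the right index is additive modulo `im Φ`, and
evaluating it along a left filtration shows that both indices agree modulo `im Φ`; dually they agree
modulo `im Ψ`, which gives `im Φ = im Ψ` and the description of the Grothendieck group.
-/

namespace Extri

/-! ### Extension groups -/

section Bifunctor

variable {C : Type u} [Category.{v} C] (E : Cᵒᵖ ⥤ C ⥤ AddCommGrpCat.{w})

lemma pull_comp {Z Z' Z'' A : C} (c : Z' ⟶ Z) (c' : Z'' ⟶ Z') (δ : Ext E Z A) :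
    pull E (c' ≫ c) δ = pull E c' (pull E c δ) := by
  simp [pull]

lemma pull_id {Z A : C} (δ : Ext E Z A) : pull E (𝟙 Z) δ = δ := by
  simp [pull]

end Bifunctor

namespace ExtriangulatedStructure

variable {C : Type u} [Category.{v} C] [Preadditive C] [HasZeroObject C] [HasBinaryBiproducts C]
  (S : ExtriangulatedStructure.{w} C)

lemma push_add_left {Z A A' : C} (a a' : A ⟶ A') (δ : Ext S.E Z A) :
    push S.E (a + a') δ = push S.E a δ + push S.E a' δ := by
  have := S.additive_right (op Z)
  simp [push, Functor.map_add]

lemma push_zero_left {Z A A' : C} (δ : Ext S.E Z A) : push S.E (0 : A ⟶ A') δ = 0 := by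
  have := S.additive_right (op Z)
  simp [push]

lemma pull_add_left {Z Z' A : C} (c c' : Z' ⟶ Z) (δ : Ext S.E Z A) :
    pull S.E (c + c') δ = pull S.E c δ + pull S.E c' δ := by
  have := S.additive_left
  simp [pull, Functor.map_add]

lemma pull_zero_left {Z Z' A : C} (δ : Ext S.E Z A) : pull S.E (0 : Z' ⟶ Z) δ = 0 := by
  have := S.additive_left
  simp [pull]

lemma pull_neg_left {Z Z' A : C} (c : Z' ⟶ Z) (δ : Ext S.E Z A) :
    pull S.E (-c) δ = -pull S.E c δ := by
  have := S.additive_left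
  simp [pull]

lemma ext_eq_zero_of_isZero_left {Z A : C} (hZ : IsZero Z) (δ : Ext S.E Z A) : δ = 0 := by
  rw [← pull_id S.E δ, hZ.eq_of_src (𝟙 Z) 0, pull_zero_left]

lemma ext_eq_zero_of_isZero_right {Z A : C} (hA : IsZero A) (δ : Ext S.E Z A) : δ = 0 := by
  rw [← push_id S.E δ, hA.eq_of_src (𝟙 A) 0, push_zero_left]

variable {S}

/-! ### Exact sequences of an extriangle -/

section Exact

lemma isTriangle_id_right (A : C) {O : C} (hO : IsZero O) (δ : Ext S.E O A) :
    S.IsTriangle (𝟙 A) (0 : A ⟶ O) δ := by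
  rw [S.ext_eq_zero_of_isZero_left hO δ]
  rw [S.isTriangle_iff (S.isTriangle_zero A O)]
  exact ⟨⟨biprod.fst, biprod.inl, by ext <;> simp [hO.eq_of_src _ (0 : O ⟶ A ⊞ O)], by simp⟩,
    by simp, hO.eq_of_tgt _ _⟩

lemma isTriangle_id_left (Z : C) {O : C} (hO : IsZero O) (δ : Ext S.E Z O) :
    S.IsTriangle (0 : O ⟶ Z) (𝟙 Z) δ := by
  rw [S.ext_eq_zero_of_isZero_right hO δ]
  rw [S.isTriangle_iff (S.isTriangle_zero O Z)]
  exact ⟨⟨biprod.snd, biprod.inr, by ext <;> simp [hO.eq_of_src _ (0 : O ⟶ O ⊞ Z)], by simp⟩,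
    by simp, by simp⟩

variable {A B Z : C} {x : A ⟶ B} {y : B ⟶ Z} {δ : Ext S.E Z A}

lemma IsTriangle.pull_eq_zero (h : S.IsTriangle x y δ) : pull S.E y δ = 0 := by
  obtain ⟨a, -, ha⟩ := S.et3_op (isTriangle_id_left B (isZero_zero C) 0) h (𝟙 B) y (by simp)
  simpa using ha.symm

lemma IsTriangle.exists_desc (h : S.IsTriangle x y δ) {W : C} (f : B ⟶ W) (hf : x ≫ f = 0) :
    ∃ g : Z ⟶ W, y ≫ g = f := by
  obtain ⟨c, hc, -⟩ := S.et3 h (isTriangle_id_left W (isZero_zero C) 0) 0 f (by simp [hf])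
  exact ⟨c, by simpa using hc⟩

lemma IsTriangle.exists_lift (h : S.IsTriangle x y δ) {W : C} (f : W ⟶ B) (hf : f ≫ y = 0) :
    ∃ g : W ⟶ A, g ≫ x = f := by
  obtain ⟨a, ha, -⟩ := S.et3_op (isTriangle_id_right W (isZero_zero C) 0) h f 0 (by simp [hf])
  exact ⟨a, by simpa using ha.symm⟩

lemma IsTriangle.exists_extend (h : S.IsTriangle x y δ) {W : C} (g : A ⟶ W)
    (hg : push S.E g δ = 0) : ∃ f : B ⟶ W, x ≫ f = g := by
  obtain ⟨b, hb, -⟩ := S.exists_hom h (isTriangle_id_right W (isZero_zero C) 0) g 0 (by simp [hg])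
  exact ⟨b, by simpa using hb⟩

lemma IsTriangle.exists_factor (h : S.IsTriangle x y δ) {W : C} (g : W ⟶ Z)
    (hg : pull S.E g δ = 0) : ∃ f : W ⟶ B, f ≫ y = g := by
  obtain ⟨b, -, hb⟩ := S.exists_hom (isTriangle_id_left W (isZero_zero C) 0) h 0 g (by simp [hg])
  exact ⟨b, by simpa using hb.symm⟩

lemma IsTriangle.exists_eq_pull (h : S.IsTriangle x y δ) {W : C} (ε : Ext S.E W A)
    (hε : push S.E x ε = 0) : ∃ c : W ⟶ Z, ε = pull S.E c δ := by
  obtain ⟨D, x', y', h'⟩ := S.exists_triangle ε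
  obtain ⟨b, hb⟩ := h'.exists_extend x hε
  obtain ⟨c, -, hc⟩ := S.et3 h' h (𝟙 A) b (by simp [hb])
  exact ⟨c, by rwa [push_id] at hc⟩

/-- Exactness of `E(W, A) ⟶ E(W, B) ⟶ E(W, Z)`. -/
lemma IsTriangle.exists_push_eq (h : S.IsTriangle x y δ) {W : C} (ε : Ext S.E W B)
    (hε : push S.E y ε = 0) : ∃ ε' : Ext S.E W A, push S.E x ε' = ε := by
  obtain ⟨D, x', y', h'⟩ := S.exists_triangle ε
  obtain ⟨K, k, δ'', d, e, -, -, -, h₂, -, h₃⟩ := S.et4 h h'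
  obtain ⟨s, hs⟩ := h₂.exists_factor (𝟙 W) (by rw [hε, map_zero])
  exact ⟨pull S.E s δ'', by rw [← pull_push, h₃, ← pull_comp, hs, pull_id]⟩

/-- An endomorphism of an extriangle that is the identity at both ends is an isomorphism in the
middle. -/
lemma IsTriangle.isIso_of_id (h : S.IsTriangle x y δ) (b : B ⟶ B) (h₁ : x ≫ b = x)
    (h₂ : b ≫ y = y) : IsIso b := by
  -- `b - 1` factors through `y` and through `x`, so that its square is zero.
  obtain ⟨p, hp⟩ := h.exists_desc (b - 𝟙 B) (by simp [h₁])
  obtain ⟨q, hq⟩ := h.exists_lift (b - 𝟙 B) (by simp [h₂])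
  have sq : (b - 𝟙 B) ≫ (b - 𝟙 B) = 0 := by
    nth_rewrite 1 [← hq]
    simp [h₁]
  have sq' : b ≫ b - b - b + 𝟙 B = 0 := by
    rw [← sq]
    simp only [Preadditive.sub_comp, Preadditive.comp_sub, Category.id_comp, Category.comp_id]
    abel
  have e : b ≫ (𝟙 B + 𝟙 B - b) = 𝟙 B := by
    simp only [Preadditive.comp_add, Preadditive.comp_sub, Category.comp_id]
    rw [← sub_eq_zero, ← neg_eq_zero, ← sq']; abel
  have e' : (𝟙 B + 𝟙 B - b) ≫ b = 𝟙 B := by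
    simp only [Preadditive.add_comp, Preadditive.sub_comp, Category.id_comp]
    rw [← sub_eq_zero, ← neg_eq_zero, ← sq']; abel
  exact ⟨_, e, e'⟩

lemma IsTriangle.isIso_of_isIso (h : S.IsTriangle x y δ) {A' B' Z' : C} {x' : A' ⟶ B'}
    {y' : B' ⟶ Z'} {δ' : Ext S.E Z' A'} (h' : S.IsTriangle x' y' δ') (a : A ≅ A') (c : Z ≅ Z')
    (b : B ⟶ B') (h₁ : x ≫ b = a.hom ≫ x') (h₂ : y ≫ c.hom = b ≫ y')
    (hδ : push S.E a.hom δ = pull S.E c.hom δ') : IsIso b := by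
  obtain ⟨b', h₁', h₂'⟩ := S.exists_hom h' h a.inv c.inv (by
    have := congrArg (pull S.E c.inv) (congrArg (push S.E a.inv) hδ)
    rw [← push_comp, ← pull_push, ← pull_comp] at this
    simpa [push_id, pull_id] using this.symm)
  have i₁ : IsIso (b ≫ b') := h.isIso_of_id _
    (by rw [← Category.assoc, h₁, Category.assoc, h₁']; simp)
    (by rw [Category.assoc, ← h₂', ← Category.assoc, ← h₂]; simp)
  have i₂ : IsIso (b' ≫ b) := h'.isIso_of_id _
    (by rw [← Category.assoc, h₁', Category.assoc, h₁]; simp)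
    (by rw [Category.assoc, ← h₂, ← Category.assoc, ← h₂']; simp)
  have m : IsSplitMono b := ⟨⟨b' ≫ inv (b ≫ b'), by
    rw [← Category.assoc]; exact IsIso.hom_inv_id _⟩⟩
  have ep : Epi b := epi_of_epi b' b
  exact isIso_of_epi_of_isSplitMono b

/-- Extriangles are closed under isomorphisms of extensions. -/
lemma IsTriangle.of_iso (h : S.IsTriangle x y δ) {A' B' Z' : C} {x' : A' ⟶ B'}
    {y' : B' ⟶ Z'} {δ' : Ext S.E Z' A'} (a : A ≅ A') (b : B ≅ B') (c : Z ≅ Z')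
    (h₁ : x ≫ b.hom = a.hom ≫ x') (h₂ : y ≫ c.hom = b.hom ≫ y')
    (hδ : push S.E a.hom δ = pull S.E c.hom δ') : S.IsTriangle x' y' δ' := by
  obtain ⟨D, x₁, y₁, h'⟩ := S.exists_triangle δ'
  obtain ⟨f, f₁, f₂⟩ := S.exists_hom h h' a.hom c.hom hδ
  have := h.isIso_of_isIso h' a c f f₁ f₂ hδ
  rw [S.isTriangle_iff h']
  refine ⟨(asIso f).symm ≪≫ b, ?_, ?_⟩
  · rw [← cancel_epi a.hom, ← h₁, ← Category.assoc, ← f₁]; simp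
  · simp [← h₂, f₂]

end Exact

end ExtriangulatedStructure

/-! ### The opposite extriangulated category -/

/-- The bifunctor `E` viewed on the opposite category: `E^op(Z, A) = E(A, Z)`. -/
abbrev opExt {C : Type u} [Category.{v} C] (E : Cᵒᵖ ⥤ C ⥤ AddCommGrpCat.{w}) :
    Cᵒᵖᵒᵖ ⥤ Cᵒᵖ ⥤ AddCommGrpCat.{w} :=
  unopUnop C ⋙ E.flip

namespace ExtriangulatedStructure

variable {C : Type u} [Category.{v} C] [Preadditive C] [HasZeroObject C] [HasBinaryBiproducts C]
  {S : ExtriangulatedStructure.{w} C}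

/-- The comparison of biproducts in `C` and in the opposite category. -/
@[simps]
noncomputable def biprodUnopIso (X Y : Cᵒᵖ) : X.unop ⊞ Y.unop ≅ (X ⊞ Y).unop where
  hom := biprod.desc (biprod.fst : X ⊞ Y ⟶ X).unop (biprod.snd : X ⊞ Y ⟶ Y).unop
  inv := biprod.lift (biprod.inl : X ⟶ X ⊞ Y).unop (biprod.inr : Y ⟶ X ⊞ Y).unop
  hom_inv_id := by
    ext <;> simp [← unop_comp]
  inv_hom_id := by
    rw [biprod.lift_desc, ← unop_comp, ← unop_comp, ← unop_add, biprod.total, unop_id]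

variable (S) in
/-- The opposite of an extriangulated category: the extriangle `A ⟶ B ⟶ Z` becomes
`Z ⟶ B ⟶ A`. -/
def opposite : ExtriangulatedStructure.{w} Cᵒᵖ where
  E := opExt S.E
  additive_left := ⟨fun {X Y f g} => by
    ext W δ
    exact S.push_add_left f.unop.unop g.unop.unop δ⟩
  additive_right Z := ⟨fun {X Y f g} => by
    ext δ
    exact S.pull_add_left f.unop g.unop δ⟩
  IsTriangle {A B Z} x y δ := S.IsTriangle (A := Z.unop) (Z := A.unop) y.unop x.unop δ
  exists_triangle {A Z} δ := by
    obtain ⟨B, x, y, h⟩ := S.exists_triangle (A := Z.unop) (Z := A.unop) δ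
    exact ⟨op B, y.op, x.op, h⟩
  isTriangle_iff {A B B' Z x y δ} h x' y' := by
    refine (S.isTriangle_iff h _ _).trans ⟨?_, ?_⟩
    · rintro ⟨b, h₁, h₂⟩
      exact ⟨b.symm.op, Quiver.Hom.unop_inj (by simp [← h₂]),
        Quiver.Hom.unop_inj (by simp [← h₁])⟩
    · rintro ⟨b, h₁, h₂⟩
      exact ⟨b.symm.unop, by simp [← h₂, ← unop_comp], by simp [← h₁, ← unop_comp]⟩
  exists_hom {A B Z A' B' Z' x y δ x' y' δ'} h h' a c hac := by
    obtain ⟨b, h₁, h₂⟩ := S.exists_hom h' h c.unop a.unop hac.symm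
    exact ⟨b.op, Quiver.Hom.unop_inj h₂.symm, Quiver.Hom.unop_inj h₁.symm⟩
  isTriangle_zero A Z := by
    rw [S.isTriangle_iff (S.isTriangle_zero Z.unop A.unop)]
    refine ⟨biprod.braiding _ _ ≪≫ biprodUnopIso A Z, by simp, ?_⟩
    ext <;> simp [← unop_comp]
  isTriangle_biprod {A B Z A' B' Z' x y δ x' y' δ'} h h' := by
    refine (S.isTriangle_biprod h h').of_iso (biprodUnopIso Z Z') (biprodUnopIso B B')
      (biprodUnopIso A A') ?_ ?_ ?_
    · ext <;> simp [← unop_comp]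
    · ext <;> simp [← unop_comp]
    · change _ = pull S.E (biprodUnopIso A A').hom
        (push S.E (biprod.fst : Z ⊞ Z' ⟶ Z).unop (pull S.E (biprod.inl : A ⟶ A ⊞ A').unop δ)
          + push S.E (biprod.snd : Z ⊞ Z' ⟶ Z').unop
            (pull S.E (biprod.inr : A' ⟶ A ⊞ A').unop δ'))
      simp only [map_add, pull_push, ← push_comp, ← pull_comp]
      congr 2 <;> congr 1 <;> simp
      all_goals congr 1; ext <;> simp [← unop_comp]
  et3 {A B Z A' B' Z' x y δ x' y' δ'} h h' a b hab := by
    obtain ⟨c, h₁, h₂⟩ := S.et3_op h' h b.unop a.unop (Quiver.Hom.op_inj hab.symm)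
    exact ⟨c.op, Quiver.Hom.unop_inj h₁.symm, h₂.symm⟩
  et3_op {A B Z A' B' Z' x y δ x' y' δ'} h h' b c hbc := by
    obtain ⟨a, h₁, h₂⟩ := S.et3 h' h c.unop b.unop (Quiver.Hom.op_inj hbc.symm)
    exact ⟨a.op, Quiver.Hom.unop_inj h₁.symm, h₂.symm⟩
  et4 {A B D Z F f f' δ g g' δ'} h h' := by
    obtain ⟨K, k, δ'', d, e, h₁, h₂, h₃, h₄, h₅, h₆⟩ := S.et4_op h' h
    exact ⟨op K, k.op, δ'', e.op, d.op, h₁, Quiver.Hom.unop_inj h₃.symm, Quiver.Hom.unop_inj h₂,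
      h₄, h₅, h₆.symm⟩
  et4_op {D A B F Z f' f δ g' g δ'} h h' := by
    obtain ⟨K, k, δ'', d, e, h₁, h₂, h₃, h₄, h₅, h₆⟩ := S.et4 h' h
    exact ⟨op K, k.op, δ'', e.op, d.op, h₁, Quiver.Hom.unop_inj h₃, Quiver.Hom.unop_inj h₂.symm,
      h₄, h₅, h₆.symm⟩

variable {A B Z : C} {x : A ⟶ B} {y : B ⟶ Z} {δ : Ext S.E Z A}

lemma IsTriangle.op (h : S.IsTriangle x y δ) : S.opposite.IsTriangle y.op x.op δ := h

/-! ### Constructions of extriangles -/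

lemma IsTriangle.nonempty_iso_biprod (h : S.IsTriangle x y (0 : Ext S.E Z A)) :
    Nonempty (B ≅ A ⊞ Z) := by
  obtain ⟨b, -, -⟩ := (S.isTriangle_iff h _ _).1 (S.isTriangle_zero A Z)
  exact ⟨b⟩

lemma IsTriangle.biprod_id (h : S.IsTriangle x y δ) (M : C) :
    S.IsTriangle (x ≫ biprod.inl : A ⟶ B ⊞ M) (biprod.map y (𝟙 M)) (pull S.E biprod.fst δ) := by
  refine (S.isTriangle_biprod h (isTriangle_id_left M (isZero_zero C) 0)).of_iso
    (isoBiprodZero (isZero_zero C)).symm (Iso.refl _) (Iso.refl _) ?_ ?_ ?_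
  · ext <;> simp [(isZero_zero C).eq_of_src _ (0 : (0 : C) ⟶ B)]
  · simp
  · simp only [map_zero, add_zero, Iso.symm_hom, isoBiprodZero_inv, Iso.refl_hom, pull_id]
    rw [← pull_push, ← push_comp, biprod.inl_fst, push_id]

lemma isTriangle_graph {W Y : C} (f : W ⟶ Y) :
    S.IsTriangle (biprod.lift f (𝟙 W)) (biprod.desc (-𝟙 Y) f) (0 : Ext S.E Y W) := by
  rw [S.isTriangle_iff (S.isTriangle_zero W Y)]
  refine ⟨⟨biprod.desc (biprod.lift f (𝟙 W)) (biprod.lift (-𝟙 Y) 0),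
    biprod.desc (biprod.lift 0 (-𝟙 Y)) (biprod.lift (𝟙 W) f), ?_, ?_⟩, ?_, ?_⟩
  all_goals ext <;> simp

/-- The homotopy pullback of a deflation `y : B ⟶ Z` along `f : W ⟶ Z`. -/
lemma IsTriangle.exists_homotopyPullback (h : S.IsTriangle x y δ) {W : C} (f : W ⟶ Z) :
    ∃ (K : C) (k : K ⟶ B ⊞ W) (ε : Ext S.E Z K),
      S.IsTriangle k (biprod.desc (-y) f) ε ∧ pull S.E (k ≫ biprod.snd) (pull S.E f δ) = 0 := by
  obtain ⟨K, k, ε, d, e, h₁, -, h₂, h₃, -, -⟩ := S.et4_op (h.biprod_id W) (isTriangle_graph f)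
  have h₄ : k ≫ biprod.snd = e := by
    simpa using congrArg (· ≫ biprod.snd) h₂
  have h₅ : biprod.map y (𝟙 W) ≫ biprod.desc (-𝟙 Z) f = biprod.desc (-y) f := by
    ext <;> simp
  refine ⟨K, k, ε, h₅ ▸ h₁, ?_⟩
  have := h₃.pull_eq_zero
  rwa [← pull_comp, ← pull_comp, Category.assoc, biprod.lift_fst, ← h₄, pull_comp] at this

lemma IsTriangle.exists_of_biprod {A' B' M : C} {x' : A' ⟶ B'} {y' : B' ⟶ Z} {δ' : Ext S.E Z A'}
    (h' : S.IsTriangle x' y' δ') {g : A ⊞ A' ⟶ M} {g' : M ⟶ Z}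
    (hM : S.IsTriangle g g' (push S.E biprod.inl δ + push S.E biprod.inr δ' : Ext S.E Z _)) :
    ∃ (i : A ⟶ M) (m : M ⟶ B'), S.IsTriangle i m (pull S.E y' δ) := by
  obtain ⟨K, k, δ'', d, e, h₁, -, -, h₂, -, h₃⟩ := S.et4 (S.isTriangle_zero A A') hM
  rw [map_add, ← push_comp, ← push_comp, biprod.inl_snd, biprod.inr_snd, push_id,
    push_zero_left, zero_add] at h₂
  obtain ⟨b, -, hb⟩ := (S.isTriangle_iff h₂ _ _).1 h'
  have h₄ : δ'' = pull S.E e δ := by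
    have := congrArg (push S.E biprod.fst) h₃
    rwa [← push_comp, biprod.inl_fst, push_id, ← pull_push, map_add, ← push_comp, ← push_comp,
      biprod.inl_fst, biprod.inr_fst, push_id, push_zero_left, add_zero] at this
  refine ⟨biprod.inl ≫ g, k ≫ b.hom, h₁.of_iso (Iso.refl _) (Iso.refl _) b (by simp) (by simp) ?_⟩
  rw [h₄, ← hb, pull_comp]
  simp [push_id]

/-- The pullback of two deflations with the same target. -/
lemma IsTriangle.exists_pullback (h : S.IsTriangle x y δ) {A' B' : C} {x' : A' ⟶ B'} {y' : B' ⟶ Z}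
    {δ' : Ext S.E Z A'} (h' : S.IsTriangle x' y' δ') :
    ∃ (M : C) (i : A ⟶ M) (m : M ⟶ B') (i' : A' ⟶ M) (m' : M ⟶ B),
      S.IsTriangle i m (pull S.E y' δ) ∧ S.IsTriangle i' m' (pull S.E y δ') := by
  obtain ⟨M, g, g', hM⟩ := S.exists_triangle
    (push S.E biprod.inl δ + push S.E biprod.inr δ' : Ext S.E Z (A ⊞ A'))
  obtain ⟨i, m, hm⟩ := h'.exists_of_biprod hM
  have hM' : S.IsTriangle ((biprod.braiding A A').inv ≫ g) g'
      (push S.E biprod.inl δ' + push S.E biprod.inr δ : Ext S.E Z (A' ⊞ A)) := by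
    refine hM.of_iso (biprod.braiding A A') (Iso.refl _) (Iso.refl _) (by simp) (by simp) ?_
    rw [map_add, ← push_comp, ← push_comp, add_comm]
    have e₁ : (biprod.inr : A' ⟶ A ⊞ A') ≫ (biprod.braiding A A').hom = biprod.inl := by
      ext <;> simp
    have e₂ : (biprod.inl : A ⟶ A ⊞ A') ≫ (biprod.braiding A A').hom = biprod.inr := by
      ext <;> simp
    rw [e₁, e₂, Iso.refl_hom, pull_id]
  obtain ⟨i', m', hm'⟩ := h.exists_of_biprod hM'
  exact ⟨M, i, m, i', m', hm, hm'⟩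

end ExtriangulatedStructure

/-! ### Elementary tensors -/

section Tensor

variable {C : Type u} [Category.{v} C] (E : Cᵒᵖ ⥤ C ⥤ AddCommGrpCat.{w})
  (G : C ⥤ AddCommGrpCat.{max u v w})

/-- The elementary tensor `δ ⊗ g` in `∫^X E(X, A) ⊗ G(X)`. -/
def tmul {A X : C} (δ : Ext E X A) (g : G.obj X) : (tensor E G).obj A :=
  QuotientAddGroup.mk (s := tensorRelations E G A) (FreeAbelianGroup.of ⟨X, δ, g⟩)

variable {E G}

lemma tmul_add_left {A X : C} (δ δ' : Ext E X A) (g : G.obj X) :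
    tmul E G (δ + δ') g = tmul E G δ g + tmul E G δ' g := by
  have h := AddSubgroup.subset_closure (TensorRel.add_left (E := E) (G := G) X δ δ' g)
  rw [sub_sub] at h
  exact ((QuotientAddGroup.eq_iff_sub_mem (N := tensorRelations E G A)).2 h)

lemma tmul_add_right {A X : C} (δ : Ext E X A) (g g' : G.obj X) :
    tmul E G δ (g + g') = tmul E G δ g + tmul E G δ g' := by
  have h := AddSubgroup.subset_closure (TensorRel.add_right (E := E) (G := G) X δ g g')
  rw [sub_sub] at h
  exact ((QuotientAddGroup.eq_iff_sub_mem (N := tensorRelations E G A)).2 h)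

lemma tmul_pull {A X Y : C} (f : X ⟶ Y) (δ : Ext E Y A) (g : G.obj X) :
    tmul E G (pull E f δ) g = tmul E G δ ((G.map f).hom g) :=
  (QuotientAddGroup.eq_iff_sub_mem (N := tensorRelations E G A)).2
    (AddSubgroup.subset_closure (TensorRel.balanced X Y f δ g))

lemma tmul_zero_left {A X : C} (g : G.obj X) : tmul E G (0 : Ext E X A) g = 0 := by
  simpa using tmul_add_left (0 : Ext E X A) 0 g

lemma tmul_zero_right {A X : C} (δ : Ext E X A) : tmul E G δ (0 : G.obj X) = 0 := by
  simpa using tmul_add_right δ (0 : G.obj X) 0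

lemma tmul_neg_left {A X : C} (δ : Ext E X A) (g : G.obj X) :
    tmul E G (-δ) g = -tmul E G δ g := by
  rw [eq_neg_iff_add_eq_zero, ← tmul_add_left, neg_add_cancel, tmul_zero_left]

lemma tensor_map_tmul {A A' X : C} (a : A ⟶ A') (δ : Ext E X A) (g : G.obj X) :
    ((tensor E G).map a).hom (tmul E G δ g) = tmul E G (push E a δ) g := by
  change QuotientAddGroup.map _ _ (FreeAbelianGroup.map (tensorGenMap E G a))
    (tensorRelations_le E G a) (QuotientAddGroup.mk _) = _
  rw [QuotientAddGroup.map_mk, FreeAbelianGroup.map_of_apply]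
  rfl

@[elab_as_elim]
lemma tensor_induction {A : C} {p : (tensor E G).obj A → Prop} (q : (tensor E G).obj A)
    (tmul : ∀ (X : C) (δ : Ext E X A) (g : G.obj X), p (tmul E G δ g))
    (add : ∀ q q', p q → p q' → p (q + q')) (zero : p 0) : p q := by
  obtain ⟨a, rfl⟩ := QuotientAddGroup.mk_surjective (s := tensorRelations E G A) q
  refine FreeAbelianGroup.induction_on (motive := fun a => p (QuotientAddGroup.mk a)) a zero
    (fun x => tmul _ _ _) (fun x _ => ?_) (fun a b ha hb => add _ _ ha hb)
  have := tmul x.1 (-x.2.1) x.2.2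
  rw [tmul_neg_left] at this
  exact this

/-- The homomorphism out of the coend `∫^X E(X, A) ⊗ G(X)` given by a balanced biadditive
family. -/
def tensorLift {A : C} {H : Type*} [AddCommGroup H] (φ : ∀ X : C, Ext E X A →+ G.obj X →+ H)
    (hφ : ∀ (X Y : C) (f : X ⟶ Y) (δ : Ext E Y A) (g : G.obj X),
      φ X (pull E f δ) g = φ Y δ ((G.map f).hom g)) : (tensor E G).obj A →+ H :=
  QuotientAddGroup.lift (tensorRelations E G A)
    (FreeAbelianGroup.lift fun p : TensorGen E G A => φ p.1 p.2.1 p.2.2) (by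
      refine (AddSubgroup.closure_le _).2 ?_
      rintro r (⟨X, δ, δ', g⟩ | ⟨X, δ, g, g'⟩ | ⟨X, Y, f, δ, g⟩) <;>
        simp [AddMonoidHom.mem_ker, hφ, sub_sub])

@[simp]
lemma tensorLift_tmul {A : C} {H : Type*} [AddCommGroup H]
    (φ : ∀ X : C, Ext E X A →+ G.obj X →+ H)
    (hφ : ∀ (X Y : C) (f : X ⟶ Y) (δ : Ext E Y A) (g : G.obj X),
      φ X (pull E f δ) g = φ Y δ ((G.map f).hom g)) {X : C} (δ : Ext E X A) (g : G.obj X) :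
    tensorLift φ hφ (tmul E G δ g) = φ X δ g := by
  exact FreeAbelianGroup.lift_apply_of _ _

variable {G' : C ⥤ AddCommGrpCat.{max u v w}}

/-- The homomorphism `δ ⊗ g ↦ δ ⊗ α(g)`. -/
def tensorMapApp (α : G ⟶ G') (A : C) : (tensor E G).obj A →+ (tensor E G').obj A :=
  tensorLift
    (fun X => AddMonoidHom.mk' (fun δ => AddMonoidHom.mk'
      (fun g => tmul E G' δ ((α.app X).hom g))
      (fun g g' => by rw [map_add]; exact tmul_add_right _ _ _))
      (fun δ δ' => by ext g; exact tmul_add_left _ _ _))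
    (fun X Y f δ g => (tmul_pull _ _ _).trans
      (congrArg (tmul E G' δ) (ConcreteCategory.congr_hom (α.naturality f) g).symm))

lemma tensorMapApp_tmul (α : G ⟶ G') {A X : C} (δ : Ext E X A) (g : G.obj X) :
    tensorMapApp α A (tmul E G δ g) = tmul E G' δ ((α.app X).hom g) :=
  tensorLift_tmul _ _ _ _

lemma tensorMapApp_naturality (α : G ⟶ G') {A A' : C} (a : A ⟶ A') (q : (tensor E G).obj A) :
    tensorMapApp α A' (((tensor E G).map a).hom q) =
      ((tensor E G').map a).hom (tensorMapApp α A q) := by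
  induction q using tensor_induction with
  | tmul X δ g =>
    rw [tensor_map_tmul, tensorMapApp_tmul, tensorMapApp_tmul, tensor_map_tmul]
  | add q q' h h' => simp only [map_add, h, h']
  | zero => simp only [map_zero]

variable (E) in
/-- The functoriality of `∫^X E(X, -) ⊗ G(X)` in `G`. -/
def tensorMap (α : G ⟶ G') : tensor E G ⟶ tensor E G' where
  app A := AddCommGrpCat.ofHom (tensorMapApp α A)
  naturality A A' a := by
    apply AddCommGrpCat.hom_ext
    apply AddMonoidHom.ext
    exact tensorMapApp_naturality α a

lemma tensorMap_app_tmul (α : G ⟶ G') {A X : C} (δ : Ext E X A) (g : G.obj X) :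
    ((tensorMap E α).app A).hom (tmul E G δ g) = tmul E G' δ ((α.app X).hom g) :=
  tensorMapApp_tmul _ _ _

end Tensor

namespace ExtriangulatedStructure

/-! ### Vanishing of elementary tensors -/

section HalfExact

variable {C : Type u} [Category.{v} C] [Preadditive C] [HasZeroObject C] [HasBinaryBiproducts C]
  (S : ExtriangulatedStructure.{w} C)

/-- An additive functor that sends the extriangles `A ⟶ B ⟶ Z` to sequences
`G(A) ⟶ G(B) ⟶ G(Z)` exact in the middle. -/
structure IsHalfExact (G : C ⥤ AddCommGrpCat.{max u v w}) : Prop where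
  additive : G.Additive
  exact : ∀ {A B Z : C} {x : A ⟶ B} {y : B ⟶ Z} {δ : Ext S.E Z A}, S.IsTriangle x y δ →
    ∀ b : G.obj B, (G.map y).hom b = 0 → ∃ a : G.obj A, (G.map x).hom a = b

variable {S} {G : C ⥤ AddCommGrpCat.{max u v w}}

omit [Preadditive C] [HasZeroObject C] [HasBinaryBiproducts C] in
lemma map_map_apply {X Y Z : C} (f : X ⟶ Y) (g : Y ⟶ Z) (a : G.obj X) :
    (G.map g).hom ((G.map f).hom a) = (G.map (f ≫ g)).hom a := by
  simp

namespace IsHalfExact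

variable (hG : S.IsHalfExact G)

include hG

lemma map_zero_left {X Y : C} (a : G.obj X) : (G.map (0 : X ⟶ Y)).hom a = 0 := by
  have := hG.additive
  simp

lemma map_add_left {X Y : C} (f g : X ⟶ Y) (a : G.obj X) :
    (G.map (f + g)).hom a = (G.map f).hom a + (G.map g).hom a := by
  have := hG.additive
  simp [Functor.map_add]

lemma map_neg_left {X Y : C} (f : X ⟶ Y) (a : G.obj X) :
    (G.map (-f)).hom a = -(G.map f).hom a := by
  have := hG.additive
  simp

/-- An element killed by `f : W ⟶ Y` comes from some `e : K ⟶ W` such that `e ≫ f` kills a given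
extension of `Y`. -/
lemma exists_lift {W Y A : C} (f : W ⟶ Y) (w : G.obj W) (hw : (G.map f).hom w = 0)
    (δ : Ext S.E Y A) : ∃ (K : C) (e : K ⟶ W) (k : G.obj K), (G.map e).hom k = w ∧
      pull S.E e (pull S.E f δ) = 0 := by
  obtain ⟨B, x, y, h⟩ := S.exists_triangle δ
  obtain ⟨K, k, ε, h₁, h₂⟩ := h.exists_homotopyPullback f
  obtain ⟨a, ha⟩ := hG.exact h₁ ((G.map biprod.inr).hom w) (by
    rw [map_map_apply, biprod.inr_desc, hw])
  refine ⟨K, k ≫ biprod.snd, a, ?_, h₂⟩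
  rw [← map_map_apply, ha, map_map_apply, biprod.inr_snd]
  simp

end IsHalfExact

/-- Two pairs `(δ, g)` and `(δ', g')` with `δ ∈ E(X, A)`, `g ∈ G(X)`, `δ' ∈ E(X', A)` and
`g' ∈ G(X')` are related if there is a span `X ⟵ W ⟶ X'` along which `δ` and `δ'` agree, and `g`
and `g'` come from a common element of `G(W)`. -/
def SpanRel {A X X' : C} (δ : Ext S.E X A) (g : G.obj X) (δ' : Ext S.E X' A) (g' : G.obj X') :
    Prop :=
  ∃ (W : C) (a : W ⟶ X) (b : W ⟶ X') (w : G.obj W), (G.map a).hom w = g ∧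
    (G.map b).hom w = g' ∧ pull S.E a δ = pull S.E b δ'

section SpanRel

variable {A X X' : C} {δ : Ext S.E X A} {g : G.obj X} {δ' : Ext S.E X' A} {g' : G.obj X'}

lemma SpanRel.of_hom (f : X ⟶ X') (h₁ : pull S.E f δ' = δ) (h₂ : (G.map f).hom g = g') :
    SpanRel δ g δ' g' :=
  ⟨X, 𝟙 _, f, g, by simp, h₂, by rw [pull_id, h₁]⟩

lemma SpanRel.symm (h : SpanRel δ g δ' g') : SpanRel δ' g' δ g := by
  obtain ⟨W, a, b, w, h₁, h₂, h₃⟩ := h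
  exact ⟨W, b, a, w, h₂, h₁, h₃.symm⟩

/-- Transitivity is where half-exactness enters: it replaces the missing pullback of spans. -/
lemma SpanRel.trans (hG : S.IsHalfExact G) {X'' : C} {δ'' : Ext S.E X'' A} {g'' : G.obj X''}
    (h : SpanRel δ g δ' g') (h' : SpanRel δ' g' δ'' g'') : SpanRel δ g δ'' g'' := by
  obtain ⟨W, a, b, w, h₁, h₂, h₃⟩ := h
  obtain ⟨V, c, d, v, h₄, h₅, h₆⟩ := h'
  obtain ⟨K, e, k, hk, he⟩ := hG.exists_lift (biprod.desc b (-c))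
    ((G.map biprod.inl).hom w + (G.map biprod.inr).hom v)
    (by rw [map_add, map_map_apply, map_map_apply, biprod.inl_desc, biprod.inr_desc,
      hG.map_neg_left, h₂, h₄, add_neg_cancel]) δ'
  have e₁ : e ≫ biprod.desc b (-c) = (e ≫ biprod.fst) ≫ b + -((e ≫ biprod.snd) ≫ c) := by
    simp [biprod.desc_eq]
  rw [← pull_comp, e₁, pull_add_left, pull_neg_left, ← sub_eq_add_neg, sub_eq_zero, pull_comp,
    pull_comp _ c, ← h₃, h₆, ← pull_comp, ← pull_comp] at he
  refine ⟨K, _, _, k, ?_, ?_, he⟩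
  · rw [Category.assoc, ← map_map_apply, hk, map_add, map_map_apply, map_map_apply,
      biprod.inl_fst_assoc, biprod.inr_fst_assoc, zero_comp, hG.map_zero_left, add_zero, h₁]
  · rw [Category.assoc, ← map_map_apply, hk, map_add, map_map_apply, map_map_apply,
      biprod.inl_snd_assoc, biprod.inr_snd_assoc, zero_comp, hG.map_zero_left, zero_add, h₅]

/-- The extension `(δ, δ')` of `X ⊞ X'` by `A`. -/
noncomputable def extDesc (δ : Ext S.E X A) (δ' : Ext S.E X' A) : Ext S.E (X ⊞ X') A :=
  pull S.E biprod.fst δ + pull S.E biprod.snd δ'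

/-- The element `(g, g')` of `G(X ⊞ X')`. -/
noncomputable def objLift (g : G.obj X) (g' : G.obj X') : G.obj (X ⊞ X') :=
  (G.map biprod.inl).hom g + (G.map biprod.inr).hom g'

lemma pull_extDesc {W : C} (f : W ⟶ X ⊞ X') : pull S.E f (extDesc δ δ') =
    pull S.E (f ≫ biprod.fst) δ + pull S.E (f ≫ biprod.snd) δ' := by
  rw [extDesc, map_add, pull_comp, pull_comp]

omit [HasZeroObject C] in
lemma map_objLift {Y : C} (f : X ⊞ X' ⟶ Y) : (G.map f).hom (objLift g g') =
    (G.map (biprod.inl ≫ f)).hom g + (G.map (biprod.inr ≫ f)).hom g' := by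
  rw [objLift, map_add, map_map_apply, map_map_apply]

lemma SpanRel.add {Y Y' : C} {ε : Ext S.E Y A} {h : G.obj Y} {ε' : Ext S.E Y' A} {h' : G.obj Y'}
    (r : SpanRel δ g δ' g') (r' : SpanRel ε h ε' h') :
    SpanRel (extDesc δ ε) (objLift g h) (extDesc δ' ε') (objLift g' h') := by
  obtain ⟨W, a, b, w, h₁, h₂, h₃⟩ := r
  obtain ⟨V, c, d, v, h₄, h₅, h₆⟩ := r'
  refine ⟨W ⊞ V, biprod.map a c, biprod.map b d, objLift w v, ?_, ?_, ?_⟩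
  · rw [map_objLift, objLift, ← h₁, ← h₄, biprod.inl_map, biprod.inr_map, map_map_apply,
      map_map_apply]
  · rw [map_objLift, objLift, ← h₂, ← h₅, biprod.inl_map, biprod.inr_map, map_map_apply,
      map_map_apply]
  · rw [pull_extDesc, pull_extDesc]
    simp only [biprod.map_fst, biprod.map_snd, pull_comp, h₃, h₆]

end SpanRel

/-- The setoid of the relation by spans. -/
def spanSetoid (hG : S.IsHalfExact G) (A : C) : Setoid (TensorGen S.E G A) where
  r p q := SpanRel p.2.1 p.2.2 q.2.1 q.2.2
  iseqv := ⟨fun p => .of_hom (𝟙 _) (pull_id _ _) (by simp), .symm, .trans hG⟩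

/-- The pairs `(δ, g)` up to spans. -/
def SpanGroup (hG : S.IsHalfExact G) (A : C) : Type (max u v w) :=
  Quotient (spanSetoid hG A)

namespace SpanGroup

variable (hG : S.IsHalfExact G) {A : C}

/-- The class of the pair `(δ, g)`. -/
def mk {X : C} (δ : Ext S.E X A) (g : G.obj X) : SpanGroup hG A :=
  Quotient.mk (spanSetoid hG A) ⟨X, δ, g⟩

variable {hG}

lemma sound {X X' : C} {δ : Ext S.E X A} {g : G.obj X} {δ' : Ext S.E X' A} {g' : G.obj X'}
    (h : SpanRel δ g δ' g') : mk hG δ g = mk hG δ' g' :=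
  Quotient.sound h

lemma exact {X X' : C} {δ : Ext S.E X A} {g : G.obj X} {δ' : Ext S.E X' A} {g' : G.obj X'}
    (h : mk hG δ g = mk hG δ' g') : SpanRel δ g δ' g' :=
  Quotient.exact h

lemma exists_rep (q : SpanGroup hG A) : ∃ (X : C) (δ : Ext S.E X A) (g : G.obj X),
    mk hG δ g = q := by
  obtain ⟨⟨X, δ, g⟩⟩ := q
  exact ⟨X, δ, g, rfl⟩

noncomputable instance : Add (SpanGroup hG A) where
  add := Quotient.map₂ (fun p q => ⟨p.1 ⊞ q.1, extDesc p.2.1 q.2.1, objLift p.2.2 q.2.2⟩)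
    fun _ _ h _ _ h' => SpanRel.add h h'

instance : Zero (SpanGroup hG A) where
  zero := mk hG (0 : Ext S.E A A) 0

instance : Neg (SpanGroup hG A) where
  neg := Quotient.map (fun p => ⟨p.1, -p.2.1, p.2.2⟩) (by
    rintro p q ⟨W, a, b, w, h₁, h₂, h₃⟩
    exact ⟨W, a, b, w, h₁, h₂, by rw [map_neg, map_neg, h₃]⟩)

lemma mk_add_mk {X X' : C} (δ : Ext S.E X A) (g : G.obj X) (δ' : Ext S.E X' A) (g' : G.obj X') :
    mk hG δ g + mk hG δ' g' = mk hG (extDesc δ δ') (objLift g g') := rfl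

lemma neg_mk {X : C} (δ : Ext S.E X A) (g : G.obj X) : -mk hG δ g = mk hG (-δ) g := rfl

lemma zero_def : (0 : SpanGroup hG A) = mk hG (0 : Ext S.E A A) 0 := rfl

protected lemma add_comm (p q : SpanGroup hG A) : p + q = q + p := by
  obtain ⟨X, δ, g, rfl⟩ := p.exists_rep
  obtain ⟨Y, ε, h, rfl⟩ := q.exists_rep
  rw [mk_add_mk, mk_add_mk]
  refine sound (.of_hom (biprod.braiding X Y).hom ?_ ?_)
  · rw [pull_extDesc, add_comm, extDesc]
    simp
  · rw [map_objLift, add_comm, objLift]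
    congr 4 <;> ext <;> simp

protected lemma zero_add (p : SpanGroup hG A) : 0 + p = p := by
  obtain ⟨X, δ, g, rfl⟩ := p.exists_rep
  rw [zero_def, mk_add_mk]
  refine sound (.of_hom biprod.snd ?_ ?_)
  · rw [extDesc, map_zero, zero_add]
  · rw [map_objLift, map_zero, zero_add, biprod.inr_snd]
    simp

protected lemma add_assoc (p q r : SpanGroup hG A) : p + q + r = p + (q + r) := by
  obtain ⟨X, δ, g, rfl⟩ := p.exists_rep
  obtain ⟨Y, ε, h, rfl⟩ := q.exists_rep
  obtain ⟨Z, ζ, k, rfl⟩ := r.exists_rep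
  simp only [mk_add_mk]
  refine sound (.of_hom (biprod.associator X Y Z).hom ?_ ?_)
  · rw [pull_extDesc, pull_extDesc, extDesc, pull_extDesc, ← add_assoc]
    simp
  · rw [map_objLift, map_objLift, objLift, map_objLift, ← add_assoc]
    have e₁ : biprod.inl ≫ biprod.inl ≫ (biprod.associator X Y Z).hom = biprod.inl := by
      ext <;> simp
    have e₂ : biprod.inr ≫ biprod.inl ≫ (biprod.associator X Y Z).hom =
        biprod.inl ≫ biprod.inr := by
      ext <;> simp
    have e₃ : biprod.inr ≫ (biprod.associator X Y Z).hom = biprod.inr ≫ biprod.inr := by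
      ext <;> simp
    rw [e₁, e₂, e₃]

protected lemma neg_add_cancel (p : SpanGroup hG A) : -p + p = 0 := by
  obtain ⟨X, δ, g, rfl⟩ := p.exists_rep
  rw [neg_mk, mk_add_mk, zero_def]
  refine sound ⟨X, biprod.lift (𝟙 X) (𝟙 X), 0, g, ?_, hG.map_zero_left _, ?_⟩
  · rw [biprod.lift_eq, hG.map_add_left, objLift, Category.id_comp, Category.id_comp]
  · rw [pull_extDesc]
    simp

noncomputable instance : AddCommGroup (SpanGroup hG A) where
  add_assoc := SpanGroup.add_assoc
  zero_add := SpanGroup.zero_add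
  add_zero p := by rw [SpanGroup.add_comm, SpanGroup.zero_add]
  neg_add_cancel := SpanGroup.neg_add_cancel
  add_comm := SpanGroup.add_comm
  nsmul := nsmulRec
  zsmul := zsmulRec

variable (hG) in
/-- The homomorphism from the coend to the group of pairs up to spans. -/
noncomputable def ofTensor (A : C) : (tensor S.E G).obj A →+ SpanGroup hG A :=
  tensorLift
    (fun X => AddMonoidHom.mk' (fun δ => AddMonoidHom.mk' (fun g => mk hG δ g)
      (fun g g' => by
        rw [mk_add_mk]
        refine (sound (.of_hom (biprod.desc (𝟙 X) (𝟙 X)) ?_ ?_)).symm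
        · rw [biprod.desc_eq, pull_add_left, Category.comp_id, Category.comp_id, extDesc]
        · rw [map_objLift, biprod.inl_desc, biprod.inr_desc]
          simp))
      (fun δ δ' => by
        ext g
        refine sound (.of_hom (biprod.lift (𝟙 X) (𝟙 X)) ?_ ?_)
        · rw [pull_extDesc, biprod.lift_fst, biprod.lift_snd, pull_id, pull_id]
        · rw [biprod.lift_eq, hG.map_add_left, objLift, Category.id_comp, Category.id_comp]))
    (fun X Y f δ g => sound (.of_hom f rfl rfl))

lemma ofTensor_tmul {X : C} (δ : Ext S.E X A) (g : G.obj X) :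
    ofTensor hG A (tmul S.E G δ g) = mk hG δ g :=
  tensorLift_tmul _ _ _ _

end SpanGroup

/-- An elementary tensor `δ ⊗ g` vanishes if and only if `g` comes from some `W ⟶ X` that
kills `δ`. -/
lemma IsHalfExact.exists_of_tmul_eq_zero (hG : S.IsHalfExact G) {A X : C} {δ : Ext S.E X A}
    {g : G.obj X} (h : tmul S.E G δ g = 0) :
    ∃ (W : C) (f : W ⟶ X) (w : G.obj W), (G.map f).hom w = g ∧ pull S.E f δ = 0 := by
  have h' := congrArg (SpanGroup.ofTensor hG A) h
  rw [map_zero, SpanGroup.ofTensor_tmul, SpanGroup.zero_def] at h'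
  obtain ⟨W, a, b, w, h₁, -, h₃⟩ := SpanGroup.exact h'
  exact ⟨W, a, w, h₁, by rw [h₃, map_zero]⟩

/-- Every element of the coend is an elementary tensor, since biproducts exist. -/
lemma exists_eq_tmul {A : C} (q : (tensor S.E G).obj A) :
    ∃ (X : C) (δ : Ext S.E X A) (g : G.obj X), tmul S.E G δ g = q := by
  induction q using tensor_induction with
  | tmul X δ g => exact ⟨X, δ, g, rfl⟩
  | add q q' h h' =>
    obtain ⟨X, δ, g, rfl⟩ := h
    obtain ⟨X', δ', g', rfl⟩ := h'
    refine ⟨X ⊞ X', extDesc δ δ', objLift g g', ?_⟩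
    rw [objLift, tmul_add_right, ← tmul_pull, ← tmul_pull, pull_extDesc, pull_extDesc]
    simp [pull_id, pull_zero_left]
  | zero => exact ⟨A, 0, 0, tmul_zero_left _⟩

variable {A B Z : C} {x : A ⟶ B} {y : B ⟶ Z} {δ : Ext S.E Z A}

lemma IsHalfExact.tensor (hG : S.IsHalfExact G) : S.IsHalfExact (tensor S.E G) where
  additive := ⟨fun {A B f g} => by
    apply AddCommGrpCat.hom_ext
    apply AddMonoidHom.ext
    intro q
    obtain ⟨X, δ, g, rfl⟩ := exists_eq_tmul q
    rw [tensor_map_tmul, push_add_left, tmul_add_left, ← tensor_map_tmul, ← tensor_map_tmul]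
    rfl⟩
  exact {A B Z x y δ} h b hb := by
    obtain ⟨X, ε, g, rfl⟩ := exists_eq_tmul b
    rw [tensor_map_tmul] at hb
    obtain ⟨W, f, w, rfl, hw⟩ := hG.exists_of_tmul_eq_zero hb
    rw [pull_push] at hw
    obtain ⟨ε', hε'⟩ := h.exists_push_eq _ hw
    exact ⟨tmul S.E G ε' w, by rw [tensor_map_tmul, hε', tmul_pull]⟩

/-- Exactness of `G(Z) ⟶ (E ⊗ G)(A) ⟶ (E ⊗ G)(B)`, where the first map is `g ↦ δ ⊗ g`. -/
lemma IsHalfExact.exists_eq_tmul_of_map_eq_zero (hG : S.IsHalfExact G) (h : S.IsTriangle x y δ)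
    (q : (Extri.tensor S.E G).obj A) (hq : ((Extri.tensor S.E G).map x).hom q = 0) :
    ∃ g : G.obj Z, tmul S.E G δ g = q := by
  obtain ⟨X, ε, g, rfl⟩ := exists_eq_tmul q
  rw [tensor_map_tmul] at hq
  obtain ⟨W, f, w, rfl, hw⟩ := hG.exists_of_tmul_eq_zero hq
  rw [pull_push] at hw
  obtain ⟨c, hc⟩ := h.exists_eq_pull _ hw
  exact ⟨(G.map c).hom w, by rw [← tmul_pull, ← tmul_pull, hc]⟩

/-- Exactness of `G(B) ⟶ G(Z) ⟶ (E ⊗ G)(A)`, where the second map is `g ↦ δ ⊗ g`. -/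
lemma IsHalfExact.exists_map_eq_of_tmul_eq_zero (hG : S.IsHalfExact G) (h : S.IsTriangle x y δ)
    (g : G.obj Z) (hg : tmul S.E G δ g = 0) : ∃ b : G.obj B, (G.map y).hom b = g := by
  obtain ⟨W, f, w, rfl, hw⟩ := hG.exists_of_tmul_eq_zero hg
  obtain ⟨f', rfl⟩ := h.exists_factor _ hw
  exact ⟨(G.map f').hom w, map_map_apply _ _ _⟩

end HalfExact

end ExtriangulatedStructure

/-! ### Balancing of the higher extensions -/

section Balancing

variable {C : Type u} [Category.{v} C] (E : Cᵒᵖ ⥤ C ⥤ AddCommGrpCat.{w})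

/-- The product `δ ⊗ g ∈ E^{n+2}(Z, A)` of `δ ∈ E(X, A)` and `g ∈ E^{n+1}(Z, X)`. -/
def lmul {n : ℕ} {Z X A : C} (δ : Ext E X A) (g : (higherExt E n Z).obj X) :
    (higherExt E (n + 1) Z).obj A :=
  tmul E (higherExt E n Z) δ g

/-- `c^* : E^{n+1}(Z, -) ⟶ E^{n+1}(Z', -)` for `c : Z' ⟶ Z`. -/
def higherPull : ∀ (n : ℕ) {Z Z' : C} (_ : Z' ⟶ Z), higherExt E n Z ⟶ higherExt E n Z'
  | 0, _, _, c => Functor.whiskerRight (E.map c.op) _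
  | n + 1, _, _, c => tensorMap E (higherPull n c)

/-- Multiplication from the right, `δ ↦ δ ⊗ ε`, by an extension `ε ∈ E(Z, X)`. -/
def rmul : ∀ (n : ℕ) {Z X : C} (_ : Ext E Z X), higherExt E n X ⟶ higherExt E (n + 1) Z
  | 0, Z, X, ε =>
    { app := fun A => AddCommGrpCat.ofHom (AddMonoidHom.mk'
        (fun δ : ULift (Ext E X A) => tmul E (higherExt E 0 Z) δ.down (ULift.up ε))
        (fun δ δ' => tmul_add_left _ _ _))
      naturality := fun A A' a => by
        apply AddCommGrpCat.hom_ext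
        apply AddMonoidHom.ext
        intro δ
        exact (tensor_map_tmul a δ.down _).symm }
  | n + 1, _, _, ε => tensorMap E (rmul n ε)

variable {E}

section lmul

variable {n : ℕ} {Z X A : C}

lemma lmul_add_right (δ : Ext E X A) (g g' : (higherExt E n Z).obj X) :
    lmul E δ (g + g') = lmul E δ g + lmul E δ g' := tmul_add_right _ _ _

lemma lmul_zero_right (δ : Ext E X A) : lmul E δ (0 : (higherExt E n Z).obj X) = 0 :=
  tmul_zero_right _

lemma map_lmul {A' : C} (a : A ⟶ A') (δ : Ext E X A) (g : (higherExt E n Z).obj X) :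
    ((higherExt E (n + 1) Z).map a).hom (lmul E δ g) = lmul E (push E a δ) g :=
  tensor_map_tmul _ _ _

lemma lmul_induction {p : (higherExt E (n + 1) Z).obj A → Prop}
    (lmul : ∀ (X : C) (δ : Ext E X A) (g : (higherExt E n Z).obj X), p (lmul E δ g))
    (add : ∀ q q', p q → p q' → p (q + q')) (zero : p 0) (q : (higherExt E (n + 1) Z).obj A) :
    p q :=
  tensor_induction q lmul add zero

lemma lmul_hom_ext {H : Type*} [AddCommGroup H] {f g : (higherExt E (n + 1) Z).obj A →+ H}
    (h : ∀ (X : C) (δ : Ext E X A) (k : (higherExt E n Z).obj X),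
      f (lmul E δ k) = g (lmul E δ k)) : f = g := by
  ext q
  refine lmul_induction (p := fun q => f q = g q) h (fun q q' h h' => ?_) ?_ q
  · rw [map_add, h, h', map_add]
  · rw [map_zero, map_zero]

lemma rmul_lmul {Y : C} (ε : Ext E Z X) (δ : Ext E Y A) (g : (higherExt E n X).obj Y) :
    ((rmul E (n + 1) ε).app A).hom (lmul E δ g) = lmul E δ (((rmul E n ε).app Y).hom g) :=
  tensorMap_app_tmul _ _ _

lemma higherPull_lmul {Z' : C} (c : Z' ⟶ Z) (δ : Ext E X A) (g : (higherExt E n Z).obj X) :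
    ((higherPull E (n + 1) c).app A).hom (lmul E δ g) =
      lmul E δ (((higherPull E n c).app X).hom g) :=
  tensorMap_app_tmul _ _ _

end lmul

lemma rmul_add (n : ℕ) {Z X : C} (ε ε' : Ext E Z X) {A : C} (q : (higherExt E n X).obj A) :
    ((rmul E n (ε + ε')).app A).hom q =
      ((rmul E n ε).app A).hom q + ((rmul E n ε').app A).hom q := by
  induction n generalizing A with
  | zero => exact tmul_add_right _ _ _
  | succ n ih =>
    refine DFunLike.congr_fun (f := ((rmul E (n + 1) (ε + ε')).app A).hom)
      (g := ((rmul E (n + 1) ε).app A).hom + ((rmul E (n + 1) ε').app A).hom)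
      (lmul_hom_ext fun Y δ g => ?_) q
    rw [AddMonoidHom.add_apply, rmul_lmul, rmul_lmul, rmul_lmul, ih, lmul_add_right]

lemma rmul_push (n : ℕ) {Z X X' : C} (c : X ⟶ X') (ε : Ext E Z X) {A : C}
    (q : (higherExt E n X').obj A) :
    ((rmul E n (push E c ε)).app A).hom q =
      ((rmul E n ε).app A).hom (((higherPull E n c).app A).hom q) := by
  induction n generalizing A with
  | zero => exact (tmul_pull (G := higherExt E 0 Z) c q.down (ULift.up ε)).symm
  | succ n ih =>
    refine DFunLike.congr_fun (f := ((rmul E (n + 1) (push E c ε)).app A).hom)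
      (g := (((rmul E (n + 1) ε).app A).hom).comp ((higherPull E (n + 1) c).app A).hom)
      (lmul_hom_ext fun Y δ g => ?_) q
    rw [AddMonoidHom.comp_apply, rmul_lmul, higherPull_lmul, rmul_lmul, ih]

lemma higherPull_rmul (n : ℕ) {Z Z' X : C} (c : Z' ⟶ Z) (ε : Ext E Z X) {A : C}
    (q : (higherExt E n X).obj A) :
    ((higherPull E (n + 1) c).app A).hom (((rmul E n ε).app A).hom q) =
      ((rmul E n (pull E c ε)).app A).hom q := by
  induction n generalizing A with
  | zero => exact higherPull_lmul (n := 0) c q.down (ULift.up ε : ULift (Ext E Z X))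
  | succ n ih =>
    refine DFunLike.congr_fun
      (f := (((higherPull E (n + 2) c).app A).hom).comp ((rmul E (n + 1) ε).app A).hom)
      (g := ((rmul E (n + 1) (pull E c ε)).app A).hom)
      (lmul_hom_ext fun Y δ g => ?_) q
    rw [AddMonoidHom.comp_apply, rmul_lmul, higherPull_lmul, rmul_lmul, ih]

/-- The groups `E^{n+2}(Z, A)` are generated by the products `g ⊗ ε` with `ε ∈ E(Z, X)` and
`g ∈ E^{n+1}(X, A)`. -/
lemma rmul_induction (n : ℕ) {Z A : C} (p : (higherExt E (n + 1) Z).obj A → Prop)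
    (rmul : ∀ (X : C) (ε : Ext E Z X) (g : (higherExt E n X).obj A),
      p (((rmul E n ε).app A).hom g))
    (add : ∀ q q', p q → p q' → p (q + q')) (zero : p 0)
    (q : (higherExt E (n + 1) Z).obj A) : p q := by
  induction n generalizing A with
  | zero =>
    exact lmul_induction
      (fun X δ (g : ULift (Ext E Z X)) => rmul X g.down (ULift.up δ)) add zero q
  | succ n ih =>
    refine lmul_induction (fun Y δ g => ?_) add zero q
    refine ih (fun g => p (lmul E δ g)) (fun X ε g => ?_) (fun q q' h h' => ?_) ?_ g
    · rw [← rmul_lmul]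
      exact rmul X ε _
    · rw [lmul_add_right]
      exact add _ _ h h'
    · rw [lmul_zero_right]
      exact zero

variable {D : Type u} [Category.{v} D] {E' : Dᵒᵖ ⥤ D ⥤ AddCommGrpCat.{w}}

/-- A contravariant functor `F` and surjective maps `E(Z, A) ⟶ E'(F A, F Z)` induce surjective
maps between the higher extensions: `δ ⊗ g` is sent to the product of the image of `g` with the
image of `δ` on the right. -/
theorem exists_higherExt_dual (F : Cᵒᵖ ⥤ D) (hF : ∀ Y : D, ∃ X : C, F.obj (op X) = Y)
    (φ : ∀ Z A : C, Ext E Z A →+ Ext E' (F.obj (op A)) (F.obj (op Z)))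
    (hφ : ∀ Z A, Function.Surjective (φ Z A))
    (φ_push : ∀ (Z A A' : C) (a : A ⟶ A') (δ : Ext E Z A),
      φ Z A' (push E a δ) = pull E' (F.map a.op) (φ Z A δ))
    (φ_pull : ∀ (Z Z' A : C) (c : Z' ⟶ Z) (δ : Ext E Z A),
      φ Z' A (pull E c δ) = push E' (F.map c.op) (φ Z A δ)) (n : ℕ) :
    ∃ Θ : ∀ Z A : C, (higherExt E n Z).obj A →+
        (higherExt E' n (F.obj (op A))).obj (F.obj (op Z)),
      (∀ (Z A A' : C) (a : A ⟶ A') (q : (higherExt E n Z).obj A),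
        Θ Z A' (((higherExt E n Z).map a).hom q) =
          ((higherPull E' n (F.map a.op)).app _).hom (Θ Z A q)) ∧
      ∀ Z A, Function.Surjective (Θ Z A) := by
  induction n with
  | zero =>
    refine ⟨fun Z A => AddMonoidHom.mk'
      (fun δ : ULift (Ext E Z A) => (ULift.up (φ Z A δ.down) : ULift (Ext E' _ _)))
      (fun δ δ' => ULift.ext _ _ (map_add (φ Z A) δ.down δ'.down)), ?_, ?_⟩
    · intro Z A A' a q
      exact ULift.ext _ _ (φ_push Z A A' a q.down)
    · intro Z A q
      obtain ⟨δ, hδ⟩ := hφ Z A q.down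
      exact ⟨ULift.up δ, ULift.ext _ _ hδ⟩
  | succ n ih =>
    obtain ⟨Θ, nat, surj⟩ := ih
    let Θ' : ∀ Z A : C, (higherExt E (n + 1) Z).obj A →+
        (higherExt E' (n + 1) (F.obj (op A))).obj (F.obj (op Z)) := fun Z A => tensorLift
      (fun X => AddMonoidHom.mk' (fun δ => (((rmul E' n (φ X A δ)).app _).hom).comp (Θ Z X))
        (fun δ δ' => by
          ext g
          rw [map_add]
          exact rmul_add n _ _ _))
      (fun X Y f δ g => by
        change ((rmul E' n (φ X A (pull E f δ))).app _).hom (Θ Z X g) =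
          ((rmul E' n (φ Y A δ)).app _).hom (Θ Z Y _)
        rw [φ_pull, rmul_push, nat])
    have Θ'_lmul : ∀ (Z A X : C) (δ : Ext E X A) (g : (higherExt E n Z).obj X),
        Θ' Z A (lmul E δ g) = ((rmul E' n (φ X A δ)).app _).hom (Θ Z X g) :=
      fun Z A X δ g => tensorLift_tmul _ _ _ _
    refine ⟨Θ', fun Z A A' a q => ?_, fun Z A q => ?_⟩
    · refine DFunLike.congr_fun (f := (Θ' Z A').comp ((higherExt E (n + 1) Z).map a).hom)
        (g := (((higherPull E' (n + 1) (F.map a.op)).app _).hom).comp (Θ' Z A))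
        (lmul_hom_ext fun X δ g => ?_) q
      rw [AddMonoidHom.comp_apply, AddMonoidHom.comp_apply, Θ'_lmul, higherPull_rmul, ← φ_push,
        ← Θ'_lmul, map_lmul]
    · refine rmul_induction n (fun q => ∃ a, Θ' Z A a = q) (fun X ε g => ?_) ?_ ?_ q
      · obtain ⟨X, rfl⟩ := hF X
        obtain ⟨δ, rfl⟩ := hφ _ _ ε
        obtain ⟨g, rfl⟩ := surj _ _ g
        exact ⟨lmul E δ g, Θ'_lmul _ _ _ _ _⟩
      · rintro _ _ ⟨a, rfl⟩ ⟨b, rfl⟩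
        exact ⟨a + b, map_add _ _ _⟩
      · exact ⟨0, map_zero _⟩

lemma subsingleton_higherExt_op_iff (n : ℕ) (Z A : C) :
    Subsingleton ((higherExt (opExt E) n (op A)).obj (op Z)) ↔
      Subsingleton ((higherExt E n Z).obj A) := by
  constructor
  · intro h
    obtain ⟨Θ, -, surj⟩ := exists_higherExt_dual (E := opExt E) (E' := E) (unopUnop C)
      (fun Y => ⟨op Y, rfl⟩) (fun Z A => AddMonoidHom.id _) (fun Z A => Function.surjective_id)
      (fun Z A A' a δ => rfl) (fun Z Z' A c δ => rfl) n
    exact (surj (op A) (op Z)).subsingleton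
  · intro h
    obtain ⟨Θ, -, surj⟩ := exists_higherExt_dual (E := E) (E' := opExt E) (𝟭 Cᵒᵖ)
      (fun Y => ⟨Y.unop, rfl⟩) (fun Z A => AddMonoidHom.id _) (fun Z A => Function.surjective_id)
      (fun Z A A' a δ => rfl) (fun Z Z' A c δ => rfl) n
    exact (surj Z A).subsingleton

lemma extVanish_op_iff (n : ℕ) (Z A : C) :
    ExtVanish (opExt E) n (op A) (op Z) ↔ ExtVanish E n Z A :=
  forall₃_congr fun _ _ _ => subsingleton_higherExt_op_iff _ _ _

end Balancing

namespace ExtriangulatedStructure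

/-! ### Vanishing of higher extensions along an extriangle -/

variable {C : Type u} [Category.{v} C] [Preadditive C] [HasZeroObject C] [HasBinaryBiproducts C]
  {S : ExtriangulatedStructure.{w} C}

lemma isHalfExact_higherExt (n : ℕ) (Z : C) : S.IsHalfExact (higherExt S.E n Z) := by
  induction n with
  | zero =>
    refine ⟨⟨fun {A B f g} => ?_⟩, fun h b hb => ?_⟩
    · apply AddCommGrpCat.hom_ext
      apply AddMonoidHom.ext
      intro δ
      exact ULift.ext _ _ (S.push_add_left f g δ.down)
    · obtain ⟨a, ha⟩ := h.exists_push_eq b.down (congrArg ULift.down hb)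
      exact ⟨ULift.up a, ULift.ext _ _ ha⟩
  | succ n ih => exact ih.tensor

lemma extVanish_iff {n : ℕ} {Z A : C} : ExtVanish S.E n Z A ↔
    ∀ j < n, ∀ q : (higherExt S.E j Z).obj A, q = 0 := by
  refine ⟨fun h j hj q => ?_, fun h i hi hin => ⟨fun q q' => ?_⟩⟩
  · have := h (j + 1) (by omega) (by omega)
    exact Subsingleton.elim (α := (higherExt S.E (j + 1 - 1) Z).obj A) _ _
  · rw [h _ (by omega) q, h _ (by omega) q']

lemma extVanish_one_iff {Z A : C} : ExtVanish S.E 1 Z A ↔ ∀ δ : Ext S.E Z A, δ = 0 := by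
  rw [extVanish_iff]
  refine ⟨fun h δ => congrArg ULift.down (h 0 one_pos (ULift.up δ)), fun h j hj q => ?_⟩
  obtain rfl : j = 0 := by omega
  exact ULift.ext _ _ (h q.down)

lemma ExtVanish.mono {m n : ℕ} {Z A : C} (h : ExtVanish S.E n Z A) (hmn : m ≤ n) :
    ExtVanish S.E m Z A :=
  fun i hi him => h i hi (him.trans hmn)

lemma ExtVanish.eq_zero {n : ℕ} {Z A : C} (h : ExtVanish S.E n Z A) (hn : 1 ≤ n)
    (δ : Ext S.E Z A) : δ = 0 :=
  extVanish_one_iff.1 (ExtVanish.mono h hn) δ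

lemma extVanish_of_isZero (n : ℕ) (M : C) {A : C} (hA : IsZero A) : ExtVanish S.E n M A := by
  refine extVanish_iff.2 fun j _ q => ?_
  have := (isHalfExact_higherExt (S := S) j M).map_zero_left (Y := A) q
  rw [← hA.eq_of_src (𝟙 A) 0] at this
  simpa using this

lemma ExtVanish.of_iso {n : ℕ} {M A A' : C} (h : ExtVanish S.E n M A) (e : A ≅ A') :
    ExtVanish S.E n M A' := by
  rw [extVanish_iff] at h ⊢
  intro j hj q
  have := map_map_apply (G := higherExt S.E j M) e.inv e.hom q
  rw [h j hj (((higherExt S.E j M).map e.inv).hom q), map_zero] at this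
  simpa using this.symm

variable {A B Z : C} {x : A ⟶ B} {y : B ⟶ Z} {δ : Ext S.E Z A} {M : C} {n : ℕ}

lemma IsTriangle.extVanish_middle (h : S.IsTriangle x y δ) (hA : ExtVanish S.E n M A)
    (hZ : ExtVanish S.E n M Z) : ExtVanish S.E n M B := by
  rw [extVanish_iff] at hA hZ ⊢
  intro j hj q
  obtain ⟨a, rfl⟩ := (isHalfExact_higherExt j M).exact h q (hZ j hj _)
  rw [hA j hj a, map_zero]

lemma IsTriangle.extVanish_right (h : S.IsTriangle x y δ) (hB : ExtVanish S.E n M B)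
    (hA : ExtVanish S.E (n + 1) M A) : ExtVanish S.E n M Z := by
  rw [extVanish_iff] at hA hB ⊢
  intro j hj q
  obtain ⟨b, rfl⟩ := (isHalfExact_higherExt j M).exists_map_eq_of_tmul_eq_zero h q
    (hA (j + 1) (by omega) _)
  rw [hB j hj b, map_zero]

lemma IsTriangle.extVanish_left (h : S.IsTriangle x y δ) (hZ : ExtVanish S.E n M Z)
    (hB : ExtVanish S.E (n + 1) M B) (hA : ExtVanish S.E 1 M A) : ExtVanish S.E (n + 1) M A := by
  rw [extVanish_iff] at hA hB hZ ⊢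
  intro j hj q
  obtain _ | j := j
  · exact hA 0 one_pos q
  · obtain ⟨g, rfl⟩ := (isHalfExact_higherExt j M).exists_eq_tmul_of_map_eq_zero h q
      (hB (j + 1) hj _)
    rw [hZ j (by omega) g]
    exact tmul_zero_right δ

end ExtriangulatedStructure

namespace ExtriangulatedStructure

open scoped ZeroObject

variable {C : Type u} [Category.{v} C] [Preadditive C] [HasZeroObject C] [HasBinaryBiproducts C]
  {S : ExtriangulatedStructure.{w} C}

/-! ### Split extriangles and Schanuel's lemma -/

section Schanuel

variable {A B Z : C} {x : A ⟶ B} {y : B ⟶ Z} {δ : Ext S.E Z A}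

lemma IsTriangle.of_iso_right (h : S.IsTriangle x y δ) {Z' : C} (e : Z ≅ Z') :
    S.IsTriangle x (y ≫ e.hom) (pull S.E e.inv δ) :=
  h.of_iso (Iso.refl _) (Iso.refl _) e (by simp) (by simp)
    (by rw [← pull_comp, e.hom_inv_id, pull_id]; exact push_id _ _)

lemma IsTriangle.nonempty_iso_of_isZero_left (h : S.IsTriangle x y δ) (hA : IsZero A) :
    Nonempty (B ≅ Z) := by
  obtain ⟨b, -, -⟩ := (S.isTriangle_iff h _ _).1 (isTriangle_id_left Z hA δ)
  exact ⟨b⟩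

/-- Schanuel's lemma: two extriangles with the same third term. -/
lemma IsTriangle.schanuel (h : S.IsTriangle x y δ) {A' B' : C} {x' : A' ⟶ B'} {y' : B' ⟶ Z}
    {δ' : Ext S.E Z A'} (h' : S.IsTriangle x' y' δ') (h₁ : pull S.E y' δ = 0)
    (h₂ : pull S.E y δ' = 0) : Nonempty (A ⊞ B' ≅ A' ⊞ B) := by
  obtain ⟨M, i, m, i', m', hm, hm'⟩ := h.exists_pullback h'
  rw [h₁] at hm
  rw [h₂] at hm'
  obtain ⟨e⟩ := hm.nonempty_iso_biprod
  obtain ⟨e'⟩ := hm'.nonempty_iso_biprod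
  exact ⟨e.symm ≪≫ e'⟩

end Schanuel

/-! ### Right filtrations and their values -/

/-- The conditions on a `(d + 1)`-cluster tilting subcategory that concern extensions of the
objects of `T` and right approximations. -/
structure IsRightTilting (S : ExtriangulatedStructure.{w} C) (d : ℕ) (T : ObjectProperty C) :
    Prop where
  exists_approx : ∀ X : C, ∃ (Z M : C) (f : Z ⟶ M) (g : M ⟶ X) (δ : Ext S.E X Z),
    S.IsTriangle f g δ ∧ T M ∧ ∀ (M' : C) (k : M' ⟶ X), T M' → ∃ l : M' ⟶ M, l ≫ g = k
  mem_iff : ∀ X : C, T X ↔ ∀ M, T M → ExtVanish S.E d M X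

/-- An additive invariant of the objects of `T` with values in a group. -/
structure IsAdditiveValue {H : Type*} [AddCommGroup H] {T : ObjectProperty C}
    (χ : ∀ X : C, T X → H) : Prop where
  iso : ∀ {X Y : C} (hX : T X) (hY : T Y), Nonempty (X ≅ Y) → χ X hX = χ Y hY
  biprod : ∀ {X Y : C} (hX : T X) (hY : T Y) (hXY : T (X ⊞ Y)), χ (X ⊞ Y) hXY = χ X hX + χ Y hY

/-- The alternating sum of the values of an invariant of the objects of `T` on the terms of a right
filtration. Invariants with values in an arbitrary group, instead of the universal one, allow to
pass to the opposite category without changing the group. -/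
def RightFiltration.value {H : Type*} [AddCommGroup H] {T : ObjectProperty C}
    (χ : ∀ X : C, T X → H) : {t : ℕ} → {X : C} → S.RightFiltration T t X → H
  | _, _, .last (Y₀ := Y₀) _ _ _ _ mem _ => χ Y₀ mem
  | _, _, .cons (Y₀ := Y₀) _ _ _ _ mem tail => χ Y₀ mem - tail.value χ

section Right

variable {d : ℕ} {T : ObjectProperty C} (h : S.IsRightTilting d T)

include h

lemma IsRightTilting.extVanish {X M : C} (hX : T X) (hM : T M) {n : ℕ} (hn : n ≤ d) :
    ExtVanish S.E n M X :=
  ExtVanish.mono ((h.mem_iff X).1 hX M hM) hn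

lemma IsRightTilting.mem_of_iso {X Y : C} (hX : T X) (e : X ≅ Y) : T Y :=
  (h.mem_iff Y).2 fun _ hM => ExtVanish.of_iso (h.extVanish hX hM le_rfl) e

lemma IsRightTilting.mem_of_isZero {X : C} (hX : IsZero X) : T X :=
  (h.mem_iff X).2 fun _ _ => extVanish_of_isZero _ _ hX

lemma IsRightTilting.mem_biprod {X Y : C} (hX : T X) (hY : T Y) : T (X ⊞ Y) :=
  (h.mem_iff _).2 fun _ hM => (S.isTriangle_zero X Y).extVanish_middle
    (h.extVanish hX hM le_rfl) (h.extVanish hY hM le_rfl)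

omit h in
lemma pull_mem_lowerExt {Z Z' A : C} (c : Z' ⟶ Z) {δ : Ext S.E Z A} (hδ : δ ∈ S.lowerExt T Z A) :
    pull S.E c δ ∈ S.lowerExt T Z' A := by
  intro M f hM
  rw [← pull_comp]
  exact hδ M _ hM

omit h in
lemma IsTriangle.mem_lowerExt_of_approx {A B Z : C} {x : A ⟶ B} {y : B ⟶ Z} {δ : Ext S.E Z A}
    (h : S.IsTriangle x y δ) (hy : ∀ (M : C) (k : M ⟶ Z), T M → ∃ l : M ⟶ B, l ≫ y = k) :
    δ ∈ S.lowerExt T Z A := by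
  intro M f hM
  obtain ⟨l, rfl⟩ := hy M f hM
  rw [pull_comp, h.pull_eq_zero, map_zero]

/-- If `X` has a right filtration of length `t`, then `E^j(T, X) = 0` for `1 ≤ j ≤ d - t`. -/
lemma RightFiltration.extVanish {t : ℕ} {X : C} (F : S.RightFiltration T t X) {i : ℕ}
    (hi : i + t ≤ d) {M : C} (hM : T M) : ExtVanish S.E i M X := by
  induction F generalizing i with
  | last x y δ tri mem hK =>
    obtain ⟨e⟩ := tri.nonempty_iso_of_isZero_left hK
    exact ExtVanish.of_iso (h.extVanish mem hM (by omega)) e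
  | cons x y δ tri mem tail ih =>
    exact tri.extVanish_right (h.extVanish mem hM (by omega)) (ih (by omega))

lemma RightFiltration.mem_lowerExt {t : ℕ} {A Z : C} (F : S.RightFiltration T t A) (ht : t < d)
    (δ : Ext S.E Z A) : δ ∈ S.lowerExt T Z A := fun _ _ hM =>
  extVanish_one_iff.1 (F.extVanish h (i := 1) (by omega) hM) _

lemma IsRightTilting.exists_rightFiltration_of_extVanish {n : ℕ} (hn : n ≤ d) (X : C)
    (hX : ∀ M, T M → ExtVanish S.E (d - n) M X) : Nonempty (S.RightFiltration T n X) := by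
  induction n generalizing X with
  | zero =>
    exact ⟨.last (0 : (0 : C) ⟶ X) (𝟙 X) 0 (isTriangle_id_left X (isZero_zero C) 0)
      ((h.mem_iff X).2 hX) (isZero_zero C)⟩
  | succ n ih =>
    obtain ⟨K, Y, x, y, δ, tri, mem, hy⟩ := h.exists_approx X
    obtain ⟨F⟩ := ih (by omega) K fun M hM => by
      have e : d - n = d - (n + 1) + 1 := by omega
      rw [e]
      refine tri.extVanish_left (hX M hM) (h.extVanish mem hM (by omega)) ?_
      -- Every extension of `M` by `K` comes from `M ⟶ X`, which lifts to `Y`.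
      refine extVanish_one_iff.2 fun ε => ?_
      obtain ⟨c, rfl⟩ := tri.exists_eq_pull ε
        (ExtVanish.eq_zero (h.extVanish mem hM le_rfl) (by omega) _)
      exact tri.mem_lowerExt_of_approx hy M c hM
    exact ⟨.cons x y δ tri mem F⟩

lemma IsRightTilting.nonempty_rightFiltration (X : C) : Nonempty (S.RightFiltration T d X) :=
  h.exists_rightFiltration_of_extVanish le_rfl X fun M _ => by
    rw [Nat.sub_self]
    exact fun i hi hi' => by omega

variable {H : Type*} [AddCommGroup H] {χ : ∀ X : C, T X → H} (hχ : IsAdditiveValue χ)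

include hχ

lemma IsAdditiveValue.eq_zero {X : C} (hX : IsZero X) (hX' : T X) : χ X hX' = 0 := by
  have h₁ := hχ.biprod hX' hX' (h.mem_biprod hX' hX')
  rw [hχ.iso (h.mem_biprod hX' hX') hX' ⟨(isoBiprodZero hX).symm⟩] at h₁
  simpa using h₁

/-- Right filtrations of length `t ≤ d` of objects that become isomorphic after adding objects of
`T`: comparison of the values, by Schanuel's lemma. -/
lemma RightFiltration.value_add_eq {t : ℕ} (ht : t ≤ d) {X X' M M' : C}
    (F : S.RightFiltration T t X) (F' : S.RightFiltration T t X') (hM : T M) (hM' : T M')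
    (e : X ⊞ M ≅ X' ⊞ M') : F.value χ + χ M hM = F'.value χ + χ M' hM' := by
  induction F generalizing X' M M' with
  | @last X Y K x y δ tri mem hK =>
    cases F' with
    | @last _ Y' K' x' y' δ' tri' mem' hK' =>
      obtain ⟨f⟩ := tri.nonempty_iso_of_isZero_left hK
      obtain ⟨f'⟩ := tri'.nonempty_iso_of_isZero_left hK'
      change χ Y mem + χ M hM = χ Y' mem' + χ M' hM'
      rw [← hχ.biprod _ _ (h.mem_biprod mem hM), ← hχ.biprod _ _ (h.mem_biprod mem' hM')]
      exact hχ.iso _ _ ⟨biprod.mapIso f (Iso.refl M) ≪≫ e ≪≫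
        (biprod.mapIso f' (Iso.refl M')).symm⟩
  | @cons t X Y K x y δ tri mem tail ih =>
    cases F' with
    | @cons _ _ Y' K' x' y' δ' tri' mem' tail' =>
      have hYM := h.mem_biprod mem hM
      have hYM' := h.mem_biprod mem' hM'
      obtain ⟨f⟩ := (tri.biprod_id M).schanuel ((tri'.biprod_id M').of_iso_right e.symm)
        (extVanish_one_iff.1 (tail.extVanish h (by omega) hYM') _)
        (extVanish_one_iff.1 (tail'.extVanish h (by omega) hYM) _)
      have key := ih (by omega) tail' hYM' hYM f
      rw [hχ.biprod mem hM, hχ.biprod mem' hM'] at key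
      change χ Y mem - tail.value χ + χ M hM = χ Y' mem' - tail'.value χ + χ M' hM'
      calc _ = (χ Y mem + χ M hM) - tail.value χ := by abel
        _ = (χ Y' mem' + χ M' hM') - tail'.value χ := by
          rw [sub_eq_sub_iff_add_eq_add, add_comm _ (tail'.value χ), ← key, add_comm]
        _ = _ := by abel

lemma RightFiltration.value_eq {t : ℕ} (ht : t ≤ d) {X : C} (F F' : S.RightFiltration T t X) :
    F.value χ = F'.value χ := by
  have h0 : T (0 : C) := h.mem_of_isZero (isZero_zero C)
  simpa using F.value_add_eq h hχ ht F' h0 h0 (Iso.refl _)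

lemma RightFiltration.exists_succ {t : ℕ} {X : C} (F : S.RightFiltration T t X) :
    ∃ F' : S.RightFiltration T (t + 1) X, F'.value χ = F.value χ := by
  induction F with
  | @last X Y K x y δ tri mem hK =>
    refine ⟨.cons x y δ tri mem (.last (0 : (0 : C) ⟶ K) (𝟙 K) 0
      (isTriangle_id_left K (isZero_zero C) 0) (h.mem_of_isZero hK) (isZero_zero C)), ?_⟩
    change χ Y mem - χ K _ = χ Y mem
    rw [hχ.eq_zero h hK, sub_zero]
  | @cons t X Y K x y δ tri mem tail ih =>
    obtain ⟨F', hF'⟩ := ih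
    refine ⟨.cons x y δ tri mem F', ?_⟩
    change χ Y mem - F'.value χ = χ Y mem - tail.value χ
    rw [hF']

/-- The horseshoe lemma for right filtrations. -/
lemma IsTriangle.exists_rightFiltration {t : ℕ} (ht : t ≤ d) {A B Z : C} {x : A ⟶ B} {y : B ⟶ Z}
    {δ : Ext S.E Z A} (tri : S.IsTriangle x y δ) (hδ : δ ∈ S.lowerExt T Z A)
    (FA : S.RightFiltration T t A) (FZ : S.RightFiltration T t Z) :
    ∃ FB : S.RightFiltration T t B, FB.value χ = FA.value χ + FZ.value χ := by
  induction FA generalizing B Z with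
  | @last A Y K k p ε triA mem hK =>
    cases FZ with
    | @last _ Y' K' k' p' ε' triZ mem' hK' =>
      obtain ⟨f⟩ := triA.nonempty_iso_of_isZero_left hK
      obtain ⟨f'⟩ := triZ.nonempty_iso_of_isZero_left hK'
      have hδ0 : δ = 0 := by
        rw [← pull_id S.E δ]
        exact hδ Z (𝟙 Z) (h.mem_of_iso mem' f')
      subst hδ0
      obtain ⟨e⟩ := tri.nonempty_iso_biprod
      have hYY := h.mem_biprod mem mem'
      have e' : Y ⊞ Y' ≅ B := biprod.mapIso f f' ≪≫ e.symm
      refine ⟨.last (0 : (0 : C) ⟶ B) (𝟙 B) 0 (isTriangle_id_left B (isZero_zero C) 0)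
        (h.mem_of_iso hYY e') (isZero_zero C), ?_⟩
      change χ B _ = χ Y mem + χ Y' mem'
      rw [← hχ.biprod mem mem' hYY]
      exact hχ.iso _ _ ⟨e'.symm⟩
  | @cons t A Y K k p ε triA mem tailA ih =>
    cases FZ with
    | @cons _ _ Y' K' k' p' ε' triZ mem' tailZ =>
      -- The pullback `P` of `B` and `Y'` over `Z` is `A ⊞ Y'`, and `Y ⊞ Y' ⟶ P ⟶ B` is the wanted
      -- deflation.
      obtain ⟨P, i, m, i', m', hm, hm'⟩ := tri.exists_pullback triZ
      rw [hδ _ p' mem'] at hm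
      obtain ⟨e⟩ := hm.nonempty_iso_biprod
      obtain ⟨L, l, δ'', a, b, h₁, -, -, h₂, -, -⟩ :=
        S.et4_op ((triA.biprod_id Y').of_iso_right e.symm) hm'
      obtain ⟨FL, hFL⟩ := ih (by omega) h₂ (tailA.mem_lowerExt h (by omega) _) tailZ
      have hYY := h.mem_biprod mem mem'
      refine ⟨.cons l _ δ'' h₁ hYY FL, ?_⟩
      change χ (Y ⊞ Y') hYY - FL.value χ = χ Y mem - tailA.value χ + (χ Y' mem' - tailZ.value χ)
      rw [hFL, hχ.biprod mem mem' hYY]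
      abel

omit hχ in
/-- Every extriangle can be replaced by one whose last two terms lie in `T`, without changing the
defect of any function that is additive on the extriangles with class in `E_T`. -/
lemma IsTriangle.exists_defect_eq {A B Z : C} {x : A ⟶ B} {y : B ⟶ Z} {δ : Ext S.E Z A}
    (tri : S.IsTriangle x y δ) (ind : C → H)
    (hind : ∀ {A B Z : C} {x : A ⟶ B} {y : B ⟶ Z} {δ : Ext S.E Z A}, S.IsTriangle x y δ →
      δ ∈ S.lowerExt T Z A → ind B = ind A + ind Z) :
    ∃ (K Y Y' : C) (k : K ⟶ Y) (p : Y ⟶ Y') (ε : Ext S.E Y' K), S.IsTriangle k p ε ∧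
      T Y ∧ T Y' ∧ ind A - ind B + ind Z = ind K - ind Y + ind Y' := by
  -- `P` is the pullback of `B` along an approximation `Y'` of `Z`, and `Y` is an approximation of
  -- `P`. Each step adds the same kernel, with class in `E_T`, to two terms of the extriangle.
  obtain ⟨L, Y', l, q, γ, triZ, hY', hq⟩ := h.exists_approx Z
  have hγ := triZ.mem_lowerExt_of_approx hq
  obtain ⟨P, i, m, i', m', hm, hm'⟩ := tri.exists_pullback triZ
  obtain ⟨N, Y, n, r, β, triP, hY, hr⟩ := h.exists_approx P
  have hβ := triP.mem_lowerExt_of_approx hr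
  obtain ⟨K, k, δ'', a, b, h₁, -, -, h₂, -, -⟩ := S.et4_op triP hm
  refine ⟨K, Y, Y', k, r ≫ m, δ'', h₁, hY, hY', ?_⟩
  rw [hind h₂ (pull_mem_lowerExt _ hβ), hind triP hβ, hind triZ hγ,
    hind hm' (pull_mem_lowerExt _ hγ)]
  abel

end Right

end ExtriangulatedStructure

namespace ExtriangulatedStructure

variable {C : Type u} [Category.{v} C] [Preadditive C] [HasZeroObject C] [HasBinaryBiproducts C]
  {S : ExtriangulatedStructure.{w} C} {d : ℕ} {T : ObjectProperty C}

/-! ### Left filtrations, by passing to the opposite category -/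

lemma IsClusterTilting.isRightTilting (hT : S.IsClusterTilting (d + 1) T) :
    S.IsRightTilting d T :=
  ⟨hT.stronglyFunctoriallyFinite.right, fun X => iff_of_eq (congrFun hT.eq_rightPerp X)⟩

/-- The remaining conditions on a cluster tilting subcategory are conditions on the opposite
category; here the higher extensions of the two categories are compared. -/
lemma IsClusterTilting.isRightTilting_op (hT : S.IsClusterTilting (d + 1) T) :
    S.opposite.IsRightTilting d T.op := by
  refine ⟨fun X => ?_, fun X => (iff_of_eq (congrFun hT.eq_leftPerp X.unop)).trans
    ⟨fun h M hM => ?_, fun h M hM => ?_⟩⟩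
  · obtain ⟨M, Z, f, g, δ, tri, hM, hf⟩ := hT.stronglyFunctoriallyFinite.left X.unop
    refine ⟨op Z, op M, g.op, f.op, δ, tri.op, hM, fun M' k hM' => ?_⟩
    obtain ⟨l, hl⟩ := hf M'.unop k.unop hM'
    exact ⟨l.op, Quiver.Hom.unop_inj hl⟩
  · exact (extVanish_op_iff d X.unop M.unop).2 (h M.unop hM)
  · exact (extVanish_op_iff d X.unop M).1 (h (op M) hM)

variable {H : Type*} [AddCommGroup H] {χ : ∀ X : C, T X → H}

/-- The alternating sum of the values of an invariant of the objects of `T` on the terms of a left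
filtration. -/
def LeftFiltration.value (χ : ∀ X : C, T X → H) : {t : ℕ} → {X : C} → S.LeftFiltration T t X → H
  | _, _, .last (X₀ := X₀) _ _ _ _ mem _ => χ X₀ mem
  | _, _, .cons (X₀ := X₀) _ _ _ _ mem tail => χ X₀ mem - tail.value χ

lemma LeftFiltration.exists_op (χ : ∀ X : C, T X → H) {t : ℕ} {X : C}
    (F : S.LeftFiltration T t X) : ∃ F' : S.opposite.RightFiltration T.op t (op X),
      F'.value (fun Y hY => χ Y.unop hY) = F.value χ := by
  induction F with
  | @last X X₀ K x y δ tri mem hK => exact ⟨.last y.op x.op δ tri.op mem hK.op, rfl⟩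
  | @cons t X X₀ K x y δ tri mem tail ih =>
    obtain ⟨F', hF'⟩ := ih
    refine ⟨.cons y.op x.op δ tri.op mem F', ?_⟩
    change χ X₀ mem - _ = χ X₀ mem - _
    rw [hF']

lemma RightFiltration.exists_unop (χ : ∀ X : C, T X → H) {t : ℕ} {X : Cᵒᵖ}
    (F : S.opposite.RightFiltration T.op t X) : ∃ F' : S.LeftFiltration T t X.unop,
      F'.value χ = F.value (fun Y hY => χ Y.unop hY) := by
  induction F with
  | @last X X₀ K x y δ tri mem hK => exact ⟨.last y.unop x.unop δ tri mem hK.unop, rfl⟩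
  | @cons t X X₀ K x y δ tri mem tail ih =>
    obtain ⟨F', hF'⟩ := ih
    refine ⟨.cons y.unop x.unop δ tri mem F', ?_⟩
    change χ X₀.unop mem - _ = χ X₀.unop mem - _
    rw [hF']

variable (h : S.opposite.IsRightTilting d T.op)

include h

lemma LeftFiltration.mem_upperExt {t : ℕ} {A Z : C} (F : S.LeftFiltration T t Z) (ht : t < d)
    (δ : Ext S.E Z A) : δ ∈ S.upperExt T Z A := by
  obtain ⟨F', -⟩ := F.exists_op (fun _ _ => (0 : ℤ))
  exact fun M g hM => F'.mem_lowerExt h ht (Z := op A) δ (op M) g.op hM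

lemma nonempty_leftFiltration (X : C) : Nonempty (S.LeftFiltration T d X) := by
  obtain ⟨F⟩ := h.nonempty_rightFiltration (op X)
  obtain ⟨F', -⟩ := F.exists_unop (fun _ _ => (0 : ℤ))
  exact ⟨F'⟩

/-- The dual of `IsTriangle.exists_defect_eq`. -/
lemma IsTriangle.exists_defect_eq_left {A B Z : C} {x : A ⟶ B} {y : B ⟶ Z} {δ : Ext S.E Z A}
    (tri : S.IsTriangle x y δ) (ind : C → H)
    (hind : ∀ {A B Z : C} {x : A ⟶ B} {y : B ⟶ Z} {δ : Ext S.E Z A}, S.IsTriangle x y δ →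
      δ ∈ S.upperExt T Z A → ind B = ind A + ind Z) :
    ∃ (K Y Y' : C) (k : Y' ⟶ Y) (p : Y ⟶ K) (ε : Ext S.E K Y'), S.IsTriangle k p ε ∧
      T Y ∧ T Y' ∧ ind A - ind B + ind Z = ind K - ind Y + ind Y' := by
  obtain ⟨K, Y, Y', k, p, ε, h₁, h₂, h₃, h₄⟩ := IsTriangle.exists_defect_eq h tri.op
    (fun X => ind X.unop) (fun {A B Z x y δ} tri' hδ => by
      rw [add_comm]
      exact hind (A := Z.unop) (Z := A.unop) tri' fun M g hM => hδ (Opposite.op M) g.op hM)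
  refine ⟨K.unop, Y.unop, Y'.unop, p.unop, k.unop, ε, h₁, h₂, h₃, Eq.trans ?_ h₄⟩
  change ind A - ind B + ind Z = ind Z - ind B + ind A
  abel

variable (hχ : IsAdditiveValue χ)

include hχ

lemma IsAdditiveValue.op :
    IsAdditiveValue (T := T.op) (fun (Y : Cᵒᵖ) hY => χ Y.unop hY) where
  iso hX hY := fun ⟨e⟩ => hχ.iso _ _ ⟨e.unop.symm⟩
  biprod {X Y} hX hY hXY := by
    have e := biprodUnopIso X Y
    have hXY' : T (X.unop ⊞ Y.unop) :=
      h.mem_of_iso (X := X ⊞ Y) (Y := Opposite.op (X.unop ⊞ Y.unop)) hXY e.op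
    rw [← hχ.biprod hX hY hXY']
    exact hχ.iso _ _ ⟨e.symm⟩

lemma LeftFiltration.value_eq {t : ℕ} (ht : t ≤ d) {X : C} (F F' : S.LeftFiltration T t X) :
    F.value χ = F'.value χ := by
  obtain ⟨G, hG⟩ := F.exists_op χ
  obtain ⟨G', hG'⟩ := F'.exists_op χ
  rw [← hG, ← hG']
  exact G.value_eq h (hχ.op h) ht G'

lemma LeftFiltration.exists_succ {t : ℕ} {X : C} (F : S.LeftFiltration T t X) :
    ∃ F' : S.LeftFiltration T (t + 1) X, F'.value χ = F.value χ := by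
  obtain ⟨G, hG⟩ := F.exists_op χ
  obtain ⟨G', hG'⟩ := G.exists_succ h (hχ.op h)
  obtain ⟨F', hF'⟩ := G'.exists_unop χ
  exact ⟨F', by rw [hF', hG', hG]⟩

/-- The horseshoe lemma for left filtrations. -/
lemma IsTriangle.exists_leftFiltration {t : ℕ} (ht : t ≤ d) {A B Z : C} {x : A ⟶ B} {y : B ⟶ Z}
    {δ : Ext S.E Z A} (tri : S.IsTriangle x y δ) (hδ : δ ∈ S.upperExt T Z A)
    (FA : S.LeftFiltration T t A) (FZ : S.LeftFiltration T t Z) :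
    ∃ FB : S.LeftFiltration T t B, FB.value χ = FA.value χ + FZ.value χ := by
  obtain ⟨GA, hGA⟩ := FA.exists_op χ
  obtain ⟨GZ, hGZ⟩ := FZ.exists_op χ
  obtain ⟨GB, hGB⟩ := tri.op.exists_rightFiltration h (hχ.op h) ht
    (fun M f hM => hδ M.unop f.unop hM) GZ GA
  obtain ⟨FB, hFB⟩ := GB.exists_unop χ
  exact ⟨FB, by rw [hFB, hGB, hGA, hGZ, add_comm]⟩

end ExtriangulatedStructure

namespace ExtriangulatedStructure

open scoped ZeroObject

variable {C : Type u} [Category.{v} C] [Preadditive C] [HasZeroObject C] [HasBinaryBiproducts C]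
  {S : ExtriangulatedStructure.{w} C} {T : ObjectProperty C}

/-! ### Universal properties of the Grothendieck groups -/

section Universal

variable {H : Type*} [AddCommGroup H]

omit [HasZeroObject C] in
lemma isAdditiveValue_splitClass (T : ObjectProperty C) :
    IsAdditiveValue (T := T) (fun X hX => splitClass X hX) where
  iso {X Y} hX hY := fun ⟨e⟩ => by
    refine congrArg (fun q => QuotientAddGroup.mk (FreeAbelianGroup.of q)) (Quotient.sound ?_)
    exact ⟨T.isoMk e⟩
  biprod {X Y} hX hY hXY := by
    have key : isoClassOf (X ⊞ Y) hXY - isoClassOf X hX - isoClassOf Y hY ∈ splitRelations T :=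
      AddSubgroup.subset_closure ⟨X, Y, hX, hY, hXY, rfl⟩
    rw [sub_sub] at key
    exact (QuotientAddGroup.eq_iff_sub_mem (N := splitRelations T)).2 key

omit [HasZeroObject C] in
lemma IsAdditiveValue.map {H' : Type*} [AddCommGroup H'] {χ : ∀ X : C, T X → H}
    (hχ : IsAdditiveValue χ) (φ : H →+ H') : IsAdditiveValue (fun X hX => φ (χ X hX)) where
  iso hX hY e := congrArg φ (hχ.iso hX hY e)
  biprod hX hY hXY := by rw [hχ.biprod hX hY hXY, map_add]

/-- The homomorphism out of `K₀^sp(T)` induced by an additive invariant. -/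
def splitLift {χ : ∀ X : C, T X → H} (hχ : IsAdditiveValue χ) : K0sp T →+ H :=
  QuotientAddGroup.lift (splitRelations T)
    (FreeAbelianGroup.lift (Quotient.lift (fun X : T.FullSubcategory => χ X.obj X.property)
      fun X Y ⟨e⟩ => hχ.iso _ _ ⟨T.ι.mapIso e⟩)) (by
    refine (AddSubgroup.closure_le _).2 ?_
    rintro _ ⟨A, B, hA, hB, hAB, rfl⟩
    rw [SetLike.mem_coe, AddMonoidHom.mem_ker, map_sub, map_sub, isoClassOf, isoClassOf,
      isoClassOf, FreeAbelianGroup.lift_apply_of, FreeAbelianGroup.lift_apply_of,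
      FreeAbelianGroup.lift_apply_of]
    change χ (A ⊞ B) hAB - χ A hA - χ B hB = 0
    rw [hχ.biprod hA hB hAB]
    abel)

omit [HasZeroObject C] in
lemma splitLift_splitClass {χ : ∀ X : C, T X → H} (hχ : IsAdditiveValue χ) (X : C) (hX : T X) :
    splitLift hχ (splitClass X hX) = χ X hX := by
  change FreeAbelianGroup.lift _ (FreeAbelianGroup.of _) = _
  rw [FreeAbelianGroup.lift_apply_of]
  rfl

omit [HasZeroObject C] in
lemma splitHom_ext {f g : K0sp T →+ H}
    (h : ∀ (X : C) (hX : T X), f (splitClass X hX) = g (splitClass X hX)) : f = g := by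
  refine QuotientAddGroup.addMonoidHom_ext _ (FreeAbelianGroup.lift_ext _ _ fun q => ?_)
  induction q using Quotient.inductionOn with
  | h X => exact h X.obj X.property

variable {F : S.ExtSubgroups} {P : ObjectProperty C}

lemma isAdditiveValue_relClass (F : S.ExtSubgroups) (P : ObjectProperty C) :
    IsAdditiveValue (T := P) (fun X hX => S.relClass F X hX) :=
  (isAdditiveValue_splitClass P).map (QuotientAddGroup.mk' (S.triangleRelations F P))

lemma IsTriangle.relClass_eq {A B Z : C} {x : A ⟶ B} {y : B ⟶ Z} {δ : Ext S.E Z A}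
    (h : S.IsTriangle x y δ) (hδ : δ ∈ F Z A) (hA : P A) (hB : P B) (hZ : P Z) :
    S.relClass F B hB = S.relClass F A hA + S.relClass F Z hZ := by
  have key : splitClass A hA - splitClass B hB + splitClass Z hZ ∈ S.triangleRelations F P :=
    AddSubgroup.subset_closure ⟨A, B, Z, x, y, δ, hA, hB, hZ, h, hδ, rfl⟩
  have := (QuotientAddGroup.eq_zero_iff _).2 key
  change S.relClass F A hA - S.relClass F B hB + S.relClass F Z hZ = 0 at this
  rw [← sub_eq_zero, ← neg_eq_zero, ← this]
  abel

variable (F P) in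
/-- A function on the objects of `P` that is additive on the extriangles with class in `F`. -/
structure IsTriangleAdditive (f : ∀ X : C, P X → H) : Prop where
  iso : ∀ {X Y : C} (hX : P X) (hY : P Y), Nonempty (X ≅ Y) → f X hX = f Y hY
  triangle : ∀ {A B Z : C} {x : A ⟶ B} {y : B ⟶ Z} {δ : Ext S.E Z A}, S.IsTriangle x y δ →
    δ ∈ F Z A → ∀ (hA : P A) (hB : P B) (hZ : P Z), f B hB = f A hA + f Z hZ

lemma isTriangleAdditive_relClass (F : S.ExtSubgroups) (P : ObjectProperty C) :
    IsTriangleAdditive F P (fun X hX => S.relClass F X hX) :=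
  ⟨(isAdditiveValue_relClass F P).iso, fun h hδ => h.relClass_eq hδ⟩

lemma IsTriangleAdditive.isAdditiveValue {f : ∀ X : C, P X → H} (hf : IsTriangleAdditive F P f) :
    IsAdditiveValue f :=
  ⟨hf.iso, fun {X Y} hX hY hXY =>
    hf.triangle (S.isTriangle_zero X Y) (zero_mem _) hX hXY hY⟩

/-- The homomorphism out of the Grothendieck group induced by an additive function. -/
def relLift {f : ∀ X : C, P X → H} (hf : IsTriangleAdditive F P f) : S.K0rel F P →+ H :=
  QuotientAddGroup.lift (S.triangleRelations F P) (splitLift hf.isAdditiveValue) (by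
    refine (AddSubgroup.closure_le _).2 ?_
    rintro _ ⟨A, B, Z, x, y, δ, hA, hB, hZ, h, hδ, rfl⟩
    rw [SetLike.mem_coe, AddMonoidHom.mem_ker, map_add, map_sub, splitLift_splitClass,
      splitLift_splitClass, splitLift_splitClass, hf.triangle h hδ hA hB hZ]
    abel)

lemma relLift_relClass {f : ∀ X : C, P X → H} (hf : IsTriangleAdditive F P f) (X : C) (hX : P X) :
    relLift hf (S.relClass F X hX) = f X hX :=
  splitLift_splitClass hf.isAdditiveValue X hX

lemma relHom_ext {f g : S.K0rel F P →+ H}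
    (h : ∀ (X : C) (hX : P X), f (S.relClass F X hX) = g (S.relClass F X hX)) : f = g :=
  QuotientAddGroup.addMonoidHom_ext _ (splitHom_ext h)

end Universal

/-! ### Evaluation of additive functions along filtrations -/

section Evaluation

variable {H : Type*} [AddCommGroup H] {F : S.ExtSubgroups} {P : ObjectProperty C}
  {f : ∀ X : C, P X → H} (hf : IsTriangleAdditive F P f) (hTP : ∀ X, T X → P X)

lemma RightFiltration.map_value {H' : Type*} [AddCommGroup H'] (φ : H →+ H')
    (χ : ∀ X : C, T X → H) {t : ℕ} {X : C} (G : S.RightFiltration T t X) :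
    φ (G.value χ) = G.value (fun X hX => φ (χ X hX)) := by
  induction G with
  | last => rfl
  | cons x y δ tri mem tail ih =>
    rw [RightFiltration.value, map_sub, ih, RightFiltration.value]

lemma LeftFiltration.map_value {H' : Type*} [AddCommGroup H'] (φ : H →+ H')
    (χ : ∀ X : C, T X → H) {t : ℕ} {X : C} (G : S.LeftFiltration T t X) :
    φ (G.value χ) = G.value (fun X hX => φ (χ X hX)) := by
  induction G with
  | last => rfl
  | cons x y δ tri mem tail ih =>
    rw [LeftFiltration.value, map_sub, ih, LeftFiltration.value]

lemma RightFiltration.altSum_eq {t : ℕ} {X : C} (G : S.RightFiltration T t X) :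
    G.altSum = G.value (fun X hX => splitClass X hX) := by
  induction G with
  | last => rfl
  | cons x y δ tri mem tail ih => rw [RightFiltration.value, ← ih, RightFiltration.altSum]

lemma LeftFiltration.altSum_eq {t : ℕ} {X : C} (G : S.LeftFiltration T t X) :
    G.altSum = G.value (fun X hX => splitClass X hX) := by
  induction G with
  | last => rfl
  | cons x y δ tri mem tail ih => rw [LeftFiltration.value, ← ih, LeftFiltration.altSum]

include hf

lemma RightFiltration.apply_eq_value {t : ℕ} (hP : ∀ s < t, ∀ X, S.lower T s X → P X)
    (hF : ∀ s < t, ∀ A, S.lower T s A → ∀ (Z : C) (δ : Ext S.E Z A), δ ∈ F Z A) {X : C}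
    (G : S.RightFiltration T t X) (hX : P X) : f X hX = G.value (fun X hX => f X (hTP X hX)) := by
  induction G with
  | last x y δ tri mem hK =>
    obtain ⟨e⟩ := tri.nonempty_iso_of_isZero_left hK
    exact (hf.iso (hTP _ mem) hX ⟨e⟩).symm
  | @cons t X Y K x y δ tri mem tail ih =>
    have hK : P K := hP t (by omega) K ⟨tail⟩
    rw [RightFiltration.value, ← ih (fun s hs => hP s (by omega)) (fun s hs => hF s (by omega)) hK,
      hf.triangle tri (hF t (by omega) K ⟨tail⟩ _ _) hK (hTP _ mem) hX, add_sub_cancel_left]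

lemma LeftFiltration.apply_eq_value {t : ℕ} (hP : ∀ s < t, ∀ X, S.upper T s X → P X)
    (hF : ∀ s < t, ∀ Z, S.upper T s Z → ∀ (A : C) (δ : Ext S.E Z A), δ ∈ F Z A) {X : C}
    (G : S.LeftFiltration T t X) (hX : P X) : f X hX = G.value (fun X hX => f X (hTP X hX)) := by
  induction G with
  | last x y δ tri mem hK =>
    obtain ⟨e⟩ := tri.op.nonempty_iso_of_isZero_left hK.op
    exact (hf.iso (hTP _ mem) hX ⟨e.unop.symm⟩).symm
  | @cons t X Y K x y δ tri mem tail ih =>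
    have hK : P K := hP t (by omega) K ⟨tail⟩
    rw [LeftFiltration.value, ← ih (fun s hs => hP s (by omega)) (fun s hs => hF s (by omega)) hK,
      hf.triangle tri (hF t (by omega) K ⟨tail⟩ _ _) hX (hTP _ mem) hK, add_sub_cancel_right]

end Evaluation

/-- A function with values in `K₀^sp(T)` that is additive on the extriangles with class in `F`, is
the identity on `T`, and satisfies `[X] = [f(X)]` in the Grothendieck group, is an isomorphism. -/
lemma IsTriangleAdditive.exists_addEquiv {F : S.ExtSubgroups} {P : ObjectProperty C}
    {f : ∀ X : C, P X → K0sp T}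
    (hf : IsTriangleAdditive F P f) (hTP : ∀ X, T X → P X)
    (hfT : ∀ X (hX : T X), f X (hTP X hX) = splitClass X hX)
    (hrel : ∀ (φ : K0sp T →+ S.K0rel F P),
      (∀ X (hX : T X), φ (splitClass X hX) = S.relClass F X (hTP X hX)) →
      ∀ X (hX : P X), φ (f X hX) = S.relClass F X hX) :
    ∃ e : S.K0rel F P ≃+ K0sp T, (∀ X (hX : P X), e (S.relClass F X hX) = f X hX) ∧
      ∀ X (hX : T X), e.symm (splitClass X hX) = S.relClass F X (hTP X hX) := by
  have hχ : IsAdditiveValue (T := T) (fun X hX => S.relClass F X (hTP X hX)) :=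
    ⟨fun hX hY => (isAdditiveValue_relClass F P).iso _ _,
      fun hX hY hXY => (isAdditiveValue_relClass F P).biprod _ _ _⟩
  refine ⟨AddMonoidHom.toAddEquiv (relLift hf) (splitLift hχ) (relHom_ext fun X hX => ?_)
    (splitHom_ext fun X hX => ?_), fun X hX => relLift_relClass hf X hX,
    fun X hX => splitLift_splitClass hχ X hX⟩
  · rw [AddMonoidHom.comp_apply, relLift_relClass, AddMonoidHom.id_apply]
    exact hrel _ (splitLift_splitClass hχ) X hX
  · rw [AddMonoidHom.comp_apply, splitLift_splitClass, relLift_relClass, AddMonoidHom.id_apply,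
      hfT]

end ExtriangulatedStructure

namespace ExtriangulatedStructure

open scoped ZeroObject

variable {C : Type u} [Category.{v} C] [Preadditive C] [HasZeroObject C] [HasBinaryBiproducts C]
  {S : ExtriangulatedStructure.{w} C} {d : ℕ} {T : ObjectProperty C}

/-! ### The indices -/

lemma isTriangleAdditive_top {H : Type*} [AddCommGroup H] {F : S.ExtSubgroups} (f : C → H)
    (hf : ∀ {A B Z : C} {x : A ⟶ B} {y : B ⟶ Z} {δ : Ext S.E Z A}, S.IsTriangle x y δ →
      δ ∈ F Z A → f B = f A + f Z) :
    IsTriangleAdditive F (⊤ : ObjectProperty C) (fun X _ => f X) := by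
  refine ⟨fun {X Y} _ _ => fun ⟨e⟩ => ?_, fun h hδ _ _ _ => hf h hδ⟩
  have h₀ : f 0 = f 0 + f 0 := hf (isTriangle_id_right (S := S) (0 : C) (isZero_zero C) 0)
    (zero_mem _)
  have h₁ : f Y = f 0 + f X :=
    hf ((isTriangle_id_left (S := S) Y (isZero_zero C) 0).of_iso_right e.symm)
      (by rw [map_zero]; exact zero_mem _)
  rw [h₁, left_eq_add.1 h₀, zero_add]

section RightIndex

variable (h : S.IsRightTilting d T)

/-- The right index of an object, computed by a chosen right filtration of length `d`. -/
noncomputable def rightInd (X : C) : K0sp T := (h.nonempty_rightFiltration X).some.altSum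

include h in
lemma RightFiltration.exists_of_le {s t : ℕ} (hst : s ≤ t) {X : C}
    (G : S.RightFiltration T s X) : ∃ G' : S.RightFiltration T t X, G'.altSum = G.altSum := by
  induction t, hst using Nat.le_induction with
  | base => exact ⟨G, rfl⟩
  | succ t hst ih =>
    obtain ⟨G', hG'⟩ := ih
    obtain ⟨G'', hG''⟩ := G'.exists_succ h (isAdditiveValue_splitClass T)
    exact ⟨G'', by rw [G''.altSum_eq, hG'', ← G'.altSum_eq, hG']⟩

include h in
lemma lower_mono {s t : ℕ} (hst : s ≤ t) {X : C} (hX : S.lower T s X) : S.lower T t X :=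
  have ⟨G', _⟩ := hX.some.exists_of_le h hst
  ⟨G'⟩

lemma RightFiltration.altSum_eq_rightInd {t : ℕ} (ht : t ≤ d) {X : C}
    (G : S.RightFiltration T t X) : G.altSum = rightInd h X := by
  obtain ⟨G', hG'⟩ := G.exists_of_le h ht
  rw [← hG', rightInd, RightFiltration.altSum_eq, RightFiltration.altSum_eq]
  exact RightFiltration.value_eq h (isAdditiveValue_splitClass T) le_rfl _ _

lemma isRightIndex_rightInd {t : ℕ} (ht : t ≤ d) {X : C} (hX : S.lower T t X) :
    S.IsRightIndex T t X (rightInd h X) :=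
  ⟨hX, fun G => G.altSum_eq_rightInd h ht⟩

lemma IsRightIndex.eq_rightInd {t : ℕ} (ht : t ≤ d) {X : C} {g : K0sp T}
    (hg : S.IsRightIndex T t X g) : g = rightInd h X := by
  obtain ⟨⟨G⟩, hG⟩ := hg
  rw [← hG G, G.altSum_eq_rightInd h ht]

lemma lower_zero_of_mem {X : C} (hX : T X) : S.lower T 0 X :=
  ⟨.last (0 : (0 : C) ⟶ X) (𝟙 X) 0 (isTriangle_id_left X (isZero_zero C) 0) hX (isZero_zero C)⟩

lemma rightInd_of_mem {X : C} (hX : T X) : rightInd h X = splitClass X hX :=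
  (RightFiltration.altSum_eq_rightInd h (Nat.zero_le d)
    (.last (0 : (0 : C) ⟶ X) (𝟙 X) 0 (isTriangle_id_left X (isZero_zero C) 0) hX
      (isZero_zero C))).symm

lemma rightInd_eq_add {A B Z : C} {x : A ⟶ B} {y : B ⟶ Z} {δ : Ext S.E Z A}
    (tri : S.IsTriangle x y δ) (hδ : δ ∈ S.lowerExt T Z A) :
    rightInd h B = rightInd h A + rightInd h Z := by
  obtain ⟨G, hG⟩ := tri.exists_rightFiltration h (isAdditiveValue_splitClass T) le_rfl hδ
    (h.nonempty_rightFiltration A).some (h.nonempty_rightFiltration Z).some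
  rw [← G.altSum_eq_rightInd h le_rfl, G.altSum_eq, hG, ← RightFiltration.altSum_eq,
    ← RightFiltration.altSum_eq]
  rfl

lemma map_rightInd {H : Type*} [AddCommGroup H] {F : S.ExtSubgroups} {P : ObjectProperty C}
    {f : ∀ X : C, P X → H} (hf : IsTriangleAdditive F P f) (hTP : ∀ X, T X → P X) {t : ℕ}
    (ht : t ≤ d) (hP : ∀ s < t, ∀ X, S.lower T s X → P X)
    (hF : ∀ s < t, ∀ A, S.lower T s A → ∀ (Z : C) (δ : Ext S.E Z A), δ ∈ F Z A)
    (φ : K0sp T →+ H) (hφ : ∀ X (hX : T X), φ (splitClass X hX) = f X (hTP X hX)) {X : C}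
    (hX : P X) (hXt : S.lower T t X) : φ (rightInd h X) = f X hX := by
  obtain ⟨G⟩ := hXt
  rw [← G.altSum_eq_rightInd h ht, G.altSum_eq, G.map_value, G.apply_eq_value hf hTP hP hF hX]
  congr 1
  funext X hX
  exact hφ X hX

end RightIndex

section LeftIndex

variable (h : S.opposite.IsRightTilting d T.op)

/-- The left index of an object, computed by a chosen left filtration of length `d`. -/
noncomputable def leftInd (X : C) : K0sp T := (nonempty_leftFiltration h X).some.altSum

include h in
lemma LeftFiltration.exists_of_le {s t : ℕ} (hst : s ≤ t) {X : C}
    (G : S.LeftFiltration T s X) : ∃ G' : S.LeftFiltration T t X, G'.altSum = G.altSum := by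
  induction t, hst using Nat.le_induction with
  | base => exact ⟨G, rfl⟩
  | succ t hst ih =>
    obtain ⟨G', hG'⟩ := ih
    obtain ⟨G'', hG''⟩ := G'.exists_succ h (isAdditiveValue_splitClass T)
    exact ⟨G'', by rw [G''.altSum_eq, hG'', ← G'.altSum_eq, hG']⟩

include h in
lemma upper_mono {s t : ℕ} (hst : s ≤ t) {X : C} (hX : S.upper T s X) : S.upper T t X :=
  have ⟨G', _⟩ := hX.some.exists_of_le h hst
  ⟨G'⟩

lemma LeftFiltration.altSum_eq_leftInd {t : ℕ} (ht : t ≤ d) {X : C}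
    (G : S.LeftFiltration T t X) : G.altSum = leftInd h X := by
  obtain ⟨G', hG'⟩ := G.exists_of_le h ht
  rw [← hG', leftInd, LeftFiltration.altSum_eq, LeftFiltration.altSum_eq]
  exact LeftFiltration.value_eq h (isAdditiveValue_splitClass T) le_rfl _ _

lemma isLeftIndex_leftInd {t : ℕ} (ht : t ≤ d) {X : C} (hX : S.upper T t X) :
    S.IsLeftIndex T t X (leftInd h X) :=
  ⟨hX, fun G => G.altSum_eq_leftInd h ht⟩

lemma IsLeftIndex.eq_leftInd {t : ℕ} (ht : t ≤ d) {X : C} {g : K0sp T}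
    (hg : S.IsLeftIndex T t X g) : g = leftInd h X := by
  obtain ⟨⟨G⟩, hG⟩ := hg
  rw [← hG G, G.altSum_eq_leftInd h ht]

lemma upper_zero_of_mem {X : C} (hX : T X) : S.upper T 0 X :=
  ⟨.last (𝟙 X) (0 : X ⟶ (0 : C)) 0 (isTriangle_id_right X (isZero_zero C) 0) hX (isZero_zero C)⟩

lemma leftInd_of_mem {X : C} (hX : T X) : leftInd h X = splitClass X hX :=
  (LeftFiltration.altSum_eq_leftInd h (Nat.zero_le d)
    (.last (𝟙 X) (0 : X ⟶ (0 : C)) 0 (isTriangle_id_right X (isZero_zero C) 0) hX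
      (isZero_zero C))).symm

lemma leftInd_eq_add {A B Z : C} {x : A ⟶ B} {y : B ⟶ Z} {δ : Ext S.E Z A}
    (tri : S.IsTriangle x y δ) (hδ : δ ∈ S.upperExt T Z A) :
    leftInd h B = leftInd h A + leftInd h Z := by
  obtain ⟨G, hG⟩ := tri.exists_leftFiltration h (isAdditiveValue_splitClass T) le_rfl hδ
    (nonempty_leftFiltration h A).some (nonempty_leftFiltration h Z).some
  rw [← G.altSum_eq_leftInd h le_rfl, G.altSum_eq, hG, ← LeftFiltration.altSum_eq,
    ← LeftFiltration.altSum_eq]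
  rfl

lemma map_leftInd {H : Type*} [AddCommGroup H] {F : S.ExtSubgroups} {P : ObjectProperty C}
    {f : ∀ X : C, P X → H} (hf : IsTriangleAdditive F P f) (hTP : ∀ X, T X → P X) {t : ℕ}
    (ht : t ≤ d) (hP : ∀ s < t, ∀ X, S.upper T s X → P X)
    (hF : ∀ s < t, ∀ Z, S.upper T s Z → ∀ (A : C) (δ : Ext S.E Z A), δ ∈ F Z A)
    (φ : K0sp T →+ H) (hφ : ∀ X (hX : T X), φ (splitClass X hX) = f X (hTP X hX)) {X : C}
    (hX : P X) (hXt : S.upper T t X) : φ (leftInd h X) = f X hX := by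
  obtain ⟨G⟩ := hXt
  rw [← G.altSum_eq_leftInd h ht, G.altSum_eq, G.map_value, G.apply_eq_value hf hTP hP hF hX]
  congr 1
  funext X hX
  exact hφ X hX

end LeftIndex

/-! ### Relative Grothendieck groups and filtered objects -/

lemma exists_addEquiv_lowerExt (h : S.IsRightTilting d T) :
    ∃ e : S.K0rel (S.lowerExt T) (⊤ : ObjectProperty C) ≃+ K0sp T,
      (∀ X : C, S.IsRightIndex T d X (e (S.relClass (S.lowerExt T) X trivial))) ∧
      (∀ (M : C) (hM : T M), e.symm (splitClass M hM) =
        S.relClass (S.lowerExt T) M trivial) := by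
  obtain ⟨e, h₁, h₂⟩ := (isTriangleAdditive_top (F := S.lowerExt T) (rightInd h)
    (rightInd_eq_add h)).exists_addEquiv (T := T) (fun _ _ => trivial)
    (fun X hX => rightInd_of_mem h hX) (fun φ hφ X hX => map_rightInd h
      (isTriangleAdditive_relClass _ _) (fun _ _ => trivial) le_rfl (fun _ _ _ _ => trivial)
      (fun s hs A ⟨G⟩ Z δ => G.mem_lowerExt h hs δ) φ hφ hX (h.nonempty_rightFiltration X))
  refine ⟨e, fun X => ?_, h₂⟩
  rw [h₁]
  exact isRightIndex_rightInd h le_rfl (h.nonempty_rightFiltration X)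

lemma exists_addEquiv_upperExt (h : S.opposite.IsRightTilting d T.op) :
    ∃ e : S.K0rel (S.upperExt T) (⊤ : ObjectProperty C) ≃+ K0sp T,
      (∀ X : C, S.IsLeftIndex T d X (e (S.relClass (S.upperExt T) X trivial))) ∧
      (∀ (M : C) (hM : T M), e.symm (splitClass M hM) =
        S.relClass (S.upperExt T) M trivial) := by
  obtain ⟨e, h₁, h₂⟩ := (isTriangleAdditive_top (F := S.upperExt T) (leftInd h)
    (leftInd_eq_add h)).exists_addEquiv (T := T) (fun _ _ => trivial)
    (fun X hX => leftInd_of_mem h hX) (fun φ hφ X hX => map_leftInd h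
      (isTriangleAdditive_relClass _ _) (fun _ _ => trivial) le_rfl (fun _ _ _ _ => trivial)
      (fun s hs A ⟨G⟩ Z δ => G.mem_upperExt h hs δ) φ hφ hX (nonempty_leftFiltration h X))
  refine ⟨e, fun X => ?_, h₂⟩
  rw [h₁]
  exact isLeftIndex_leftInd h le_rfl (nonempty_leftFiltration h X)

/-- All extriangles with terms in `T_t` have class in `E_T`, as `t < d`. -/
lemma exists_addEquiv_lower (h : S.IsRightTilting d T) {t : ℕ} (ht : t < d) :
    ∃ e : S.K0rel S.allExt (S.lower T t) ≃+ K0sp T,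
      ∀ (X : C) (hX : S.lower T t X), S.IsRightIndex T t X (e (S.relClass S.allExt X hX)) := by
  have hTP : ∀ X, T X → S.lower T t X := fun X hX =>
    lower_mono h (Nat.zero_le t) (lower_zero_of_mem hX)
  have hf := isTriangleAdditive_top (F := S.lowerExt T) (rightInd h) (rightInd_eq_add h)
  have hf' : IsTriangleAdditive S.allExt (S.lower T t) (fun X _ => rightInd h X) :=
    ⟨fun hX hY => hf.iso trivial trivial, fun tri _ ⟨G⟩ _ _ =>
      rightInd_eq_add h tri (G.mem_lowerExt h ht _)⟩
  obtain ⟨e, h₁, -⟩ := hf'.exists_addEquiv hTP (fun X hX => rightInd_of_mem h hX)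
    (fun φ hφ X hX => map_rightInd h (isTriangleAdditive_relClass S.allExt _) hTP ht.le
      (fun s hs X hX => lower_mono h hs.le hX) (fun _ _ _ _ _ _ => trivial) φ hφ hX hX)
  refine ⟨e, fun X hX => ?_⟩
  rw [h₁]
  exact isRightIndex_rightInd h ht.le hX

/-- All extriangles with terms in `T^t` have class in `E^T`, as `t < d`. -/
lemma exists_addEquiv_upper (h : S.opposite.IsRightTilting d T.op) {t : ℕ} (ht : t < d) :
    ∃ e : S.K0rel S.allExt (S.upper T t) ≃+ K0sp T,
      ∀ (X : C) (hX : S.upper T t X), S.IsLeftIndex T t X (e (S.relClass S.allExt X hX)) := by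
  have hTP : ∀ X, T X → S.upper T t X := fun X hX =>
    upper_mono h (Nat.zero_le t) (upper_zero_of_mem hX)
  have hf := isTriangleAdditive_top (F := S.upperExt T) (leftInd h) (leftInd_eq_add h)
  have hf' : IsTriangleAdditive S.allExt (S.upper T t) (fun X _ => leftInd h X) :=
    ⟨fun hX hY => hf.iso trivial trivial, fun tri _ _ _ ⟨G⟩ =>
      leftInd_eq_add h tri (G.mem_upperExt h ht _)⟩
  obtain ⟨e, h₁, -⟩ := hf'.exists_addEquiv hTP (fun X hX => leftInd_of_mem h hX)
    (fun φ hφ X hX => map_leftInd h (isTriangleAdditive_relClass S.allExt _) hTP ht.le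
      (fun s hs X hX => upper_mono h hs.le hX) (fun _ _ _ _ _ _ => trivial) φ hφ hX hX)
  refine ⟨e, fun X hX => ?_⟩
  rw [h₁]
  exact isLeftIndex_leftInd h ht.le hX

/-! ### The index Grothendieck group -/

section IndexGroup

variable (h : S.IsRightTilting d T) (h' : S.opposite.IsRightTilting d T.op)

include h'

lemma rightInd_defect_mem_imPhi (hd : 1 ≤ d) {A B Z : C} {x : A ⟶ B} {y : B ⟶ Z}
    {δ : Ext S.E Z A} (tri : S.IsTriangle x y δ) :
    rightInd h A - rightInd h B + rightInd h Z ∈ S.imPhi T d := by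
  obtain ⟨K, Y, Y', k, p, ε, triK, hY, hY', e⟩ :=
    tri.exists_defect_eq h (rightInd h) (rightInd_eq_add h)
  rw [e, rightInd_of_mem h hY, rightInd_of_mem h hY', sub_add]
  -- The sequence `K ⟶ Y ⟶ Y'` is a left filtration of length `1` of `K`.
  let G : S.LeftFiltration T 1 K := .cons k p ε triK hY
    (.last (𝟙 Y') (0 : Y' ⟶ (0 : C)) 0 (isTriangle_id_right Y' (isZero_zero C) 0) hY'
      (isZero_zero C))
  exact AddSubgroup.subset_closure ⟨_, K, rightInd h K, splitClass Y hY - splitClass Y' hY',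
    ⟨Iso.refl _⟩, isRightIndex_rightInd h le_rfl (h.nonempty_rightFiltration K),
    ⟨⟨G⟩, fun G' => (G'.altSum_eq_leftInd h' hd).trans (G.altSum_eq_leftInd h' hd).symm⟩, rfl⟩

include h in
lemma leftInd_defect_mem_imPsi (hd : 1 ≤ d) {A B Z : C} {x : A ⟶ B} {y : B ⟶ Z}
    {δ : Ext S.E Z A} (tri : S.IsTriangle x y δ) :
    leftInd h' A - leftInd h' B + leftInd h' Z ∈ S.imPsi T d := by
  obtain ⟨K, Y, Y', k, p, ε, triK, hY, hY', e⟩ :=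
    tri.exists_defect_eq_left h' (leftInd h') (leftInd_eq_add h')
  rw [e, leftInd_of_mem h' hY, leftInd_of_mem h' hY', sub_add]
  -- The sequence `Y' ⟶ Y ⟶ K` is a right filtration of length `1` of `K`.
  let G : S.RightFiltration T 1 K := .cons k p ε triK hY
    (.last (0 : (0 : C) ⟶ Y') (𝟙 Y') 0 (isTriangle_id_left Y' (isZero_zero C) 0) hY'
      (isZero_zero C))
  exact AddSubgroup.subset_closure ⟨_, K, leftInd h' K, splitClass Y hY - splitClass Y' hY',
    ⟨Iso.refl _⟩, isLeftIndex_leftInd h' le_rfl (nonempty_leftFiltration h' K),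
    ⟨⟨G⟩, fun G' => (G'.altSum_eq_rightInd h hd).trans (G.altSum_eq_rightInd h hd).symm⟩, rfl⟩

omit h' in
/-- A function whose defect on every extriangle lies in `N` is additive modulo `N`. -/
lemma isTriangleAdditive_mk {H : Type*} [AddCommGroup H] (N : AddSubgroup H) (f : C → H)
    (hf : ∀ {A B Z : C} {x : A ⟶ B} {y : B ⟶ Z} {δ : Ext S.E Z A}, S.IsTriangle x y δ →
      f A - f B + f Z ∈ N) :
    IsTriangleAdditive S.allExt (⊤ : ObjectProperty C) (fun X _ => QuotientAddGroup.mk' N (f X)) :=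
  isTriangleAdditive_top (fun X => QuotientAddGroup.mk' N (f X)) fun {A B Z x y δ} tri _ => by
    have key := (QuotientAddGroup.eq_zero_iff _).2 (hf tri)
    change QuotientAddGroup.mk' N _ = 0 at key
    rw [map_add, map_sub] at key
    rw [← sub_eq_zero, ← neg_eq_zero, ← key]
    abel

/-- Modulo `im Ψ` the left index is additive on all extriangles, so that it can be computed by a
right filtration. -/
lemma rightInd_sub_leftInd_mem_imPsi (hd : 1 ≤ d) (X : C) :
    rightInd h X - leftInd h' X ∈ S.imPsi T d := by
  have key := map_rightInd h (isTriangleAdditive_mk (S.imPsi T d) (leftInd h')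
    (leftInd_defect_mem_imPsi h h' hd)) (fun _ _ => trivial) le_rfl (fun _ _ _ _ => trivial)
    (fun _ _ _ _ _ _ => trivial) (QuotientAddGroup.mk' (S.imPsi T d))
    (fun M hM => by rw [leftInd_of_mem h' hM]) (X := X) trivial (h.nonempty_rightFiltration X)
  exact QuotientAddGroup.eq_iff_sub_mem.1 key

/-- Modulo `im Φ` the right index is additive on all extriangles, so that it can be computed by a
left filtration. -/
lemma leftInd_sub_rightInd_mem_imPhi (hd : 1 ≤ d) (X : C) :
    leftInd h' X - rightInd h X ∈ S.imPhi T d := by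
  have key := map_leftInd h' (isTriangleAdditive_mk (S.imPhi T d) (rightInd h)
    (rightInd_defect_mem_imPhi h h' hd)) (fun _ _ => trivial) le_rfl (fun _ _ _ _ => trivial)
    (fun _ _ _ _ _ _ => trivial) (QuotientAddGroup.mk' (S.imPhi T d))
    (fun M hM => by rw [rightInd_of_mem h hM]) (X := X) trivial (nonempty_leftFiltration h' X)
  exact QuotientAddGroup.eq_iff_sub_mem.1 key

include h

lemma imPhi_eq_imPsi (hd : 1 ≤ d) : S.imPhi T d = S.imPsi T d := by
  refine le_antisymm ((AddSubgroup.closure_le _).2 ?_) ((AddSubgroup.closure_le _).2 ?_)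
  · rintro _ ⟨M, X, r, l, -, hr, hl, rfl⟩
    rw [hr.eq_rightInd h le_rfl, hl.eq_leftInd h' hd]
    exact rightInd_sub_leftInd_mem_imPsi h h' hd X
  · rintro _ ⟨M, X, l, r, -, hl, hr, rfl⟩
    rw [hr.eq_rightInd h hd, hl.eq_leftInd h' le_rfl]
    exact leftInd_sub_rightInd_mem_imPhi h h' hd X

lemma exists_addEquiv_K0in (hd : 1 ≤ d) :
    ∃ e : S.K0rel S.allExt (⊤ : ObjectProperty C) ≃+ S.K0in T d, ∀ X : C,
      e (S.relClass S.allExt X trivial) = QuotientAddGroup.mk (leftInd h' X) ∧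
      e (S.relClass S.allExt X trivial) = QuotientAddGroup.mk (rightInd h X) := by
  have hf := isTriangleAdditive_mk (S.imPhi T d) (rightInd h) (rightInd_defect_mem_imPhi h h' hd)
  have hrel := isTriangleAdditive_relClass S.allExt (⊤ : ObjectProperty C)
  have hχ : IsAdditiveValue (T := T) (fun X _ => S.relClass S.allExt (P := ⊤) X trivial) :=
    ⟨fun _ _ => (isAdditiveValue_relClass S.allExt ⊤).iso _ _,
      fun _ _ _ => (isAdditiveValue_relClass S.allExt ⊤).biprod _ _ _⟩
  have hR : ∀ X, splitLift hχ (rightInd h X) = S.relClass S.allExt X trivial := fun X =>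
    map_rightInd h hrel (fun _ _ => trivial) le_rfl (fun _ _ _ _ => trivial)
      (fun _ _ _ _ _ _ => trivial) _ (splitLift_splitClass hχ) trivial
      (h.nonempty_rightFiltration X)
  have hL : ∀ X, splitLift hχ (leftInd h' X) = S.relClass S.allExt X trivial := fun X =>
    map_leftInd h' hrel (fun _ _ => trivial) le_rfl (fun _ _ _ _ => trivial)
      (fun _ _ _ _ _ _ => trivial) _ (splitLift_splitClass hχ) trivial
      (nonempty_leftFiltration h' X)
  let ψ : S.K0in T d →+ S.K0rel S.allExt (⊤ : ObjectProperty C) :=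
    QuotientAddGroup.lift (S.imPhi T d) (splitLift hχ) (by
      refine (AddSubgroup.closure_le _).2 ?_
      rintro _ ⟨M, X, r, l, -, hr, hl, rfl⟩
      rw [hr.eq_rightInd h le_rfl, hl.eq_leftInd h' hd, SetLike.mem_coe, AddMonoidHom.mem_ker,
        map_sub, hR, hL, sub_self])
  have hψ : ∀ g, ψ (QuotientAddGroup.mk' (S.imPhi T d) g) = splitLift hχ g := fun g => rfl
  refine ⟨AddMonoidHom.toAddEquiv (relLift hf) ψ (relHom_ext fun X hX => ?_)
    (QuotientAddGroup.addMonoidHom_ext _ (splitHom_ext fun X hX => ?_)), fun X => ⟨?_, ?_⟩⟩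
  · rw [AddMonoidHom.comp_apply, relLift_relClass, hψ, hR, AddMonoidHom.id_apply]
  · rw [AddMonoidHom.comp_apply, AddMonoidHom.comp_apply, AddMonoidHom.comp_apply, hψ,
      splitLift_splitClass, relLift_relClass, rightInd_of_mem h hX, AddMonoidHom.id_apply]
  · refine (relLift_relClass hf X trivial).trans ?_
    refine (QuotientAddGroup.eq_iff_sub_mem.2 ?_).symm
    exact leftInd_sub_rightInd_mem_imPhi h h' hd X
  · exact relLift_relClass hf X trivial

end IndexGroup

/-! ### Two cluster tilting subcategories -/

section TwoSubcategories

variable {U : ObjectProperty C} (hT : S.opposite.IsRightTilting 1 T.op)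
  (hU : S.IsRightTilting 1 U)

lemma isAdditiveValue_rightInd (T : ObjectProperty C) :
    IsAdditiveValue (T := T) (fun X _ => rightInd hU X) :=
  have hf := (isTriangleAdditive_top (F := S.lowerExt U) (rightInd hU)
    (rightInd_eq_add hU)).isAdditiveValue
  ⟨fun _ _ => hf.iso trivial trivial, fun _ _ _ => hf.biprod trivial trivial trivial⟩

lemma isAdditiveValue_leftInd (U : ObjectProperty C) :
    IsAdditiveValue (T := U) (fun X _ => leftInd hT X) :=
  have hf := (isTriangleAdditive_top (F := S.upperExt T) (leftInd hT)
    (leftInd_eq_add hT)).isAdditiveValue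
  ⟨fun _ _ => hf.iso trivial trivial, fun _ _ _ => hf.biprod trivial trivial trivial⟩

/-- For `X` in `T`, the extriangle `P ⟶ Y ⟶ X` given by a right `U`-filtration of length `1` has
class in `E^T`, because `E(X, T) = 0`. -/
lemma splitLift_leftInd_rightInd {X : C} (hX : T X) :
    splitLift (isAdditiveValue_leftInd hT U) (rightInd hU X) = splitClass X hX := by
  obtain ⟨G⟩ := hU.nonempty_rightFiltration X
  rw [← G.altSum_eq_rightInd hU le_rfl, ← leftInd_of_mem hT hX]
  cases G with
  | @cons _ _ Y P x y δ tri mem tail =>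
    cases tail with
    | @last _ Y' K x' y' δ' tri' mem' hK =>
      change splitLift _ (splitClass Y mem - splitClass Y' mem') = _
      obtain ⟨e⟩ := tri'.nonempty_iso_of_isZero_left hK
      obtain ⟨G'⟩ := upper_zero_of_mem (S := S) hX
      rw [map_sub, splitLift_splitClass, splitLift_splitClass,
        leftInd_eq_add hT tri (G'.mem_upperExt hT one_pos δ),
        (isAdditiveValue_leftInd hT (⊤ : ObjectProperty C)).iso (X := Y') (Y := P) trivial trivial
          ⟨e⟩, add_sub_cancel_left]

lemma splitLift_rightInd_leftInd {Y : C} (hY : U Y) :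
    splitLift (isAdditiveValue_rightInd hU T) (leftInd hT Y) = splitClass Y hY := by
  obtain ⟨G⟩ := nonempty_leftFiltration hT Y
  rw [← G.altSum_eq_leftInd hT le_rfl, ← rightInd_of_mem hU hY]
  cases G with
  | @cons _ _ X P x y δ tri mem tail =>
    cases tail with
    | @last _ X' K x' y' δ' tri' mem' hK =>
      change splitLift _ (splitClass X mem - splitClass X' mem') = _
      obtain ⟨e⟩ := tri'.op.nonempty_iso_of_isZero_left hK.op
      obtain ⟨G'⟩ := lower_zero_of_mem (S := S) hY
      rw [map_sub, splitLift_splitClass, splitLift_splitClass,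
        rightInd_eq_add hU tri (G'.mem_lowerExt hU one_pos δ),
        (isAdditiveValue_rightInd hU (⊤ : ObjectProperty C)).iso (X := X') (Y := P) trivial trivial
          ⟨e.unop.symm⟩, add_sub_cancel_right]

include hT hU in
lemma exists_addEquiv_of_isRightTilting :
    ∃ e : K0sp T ≃+ K0sp U,
      (∀ (X : C) (hX : T X), S.IsRightIndex U 1 X (e (splitClass X hX))) ∧
      (∀ (Y : C) (hY : U Y), S.IsLeftIndex T 1 Y (e.symm (splitClass Y hY))) := by
  refine ⟨AddMonoidHom.toAddEquiv (splitLift (isAdditiveValue_rightInd hU T))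
    (splitLift (isAdditiveValue_leftInd hT U)) (splitHom_ext fun X hX => ?_)
    (splitHom_ext fun Y hY => ?_), fun X hX => ?_, fun Y hY => ?_⟩
  · rw [AddMonoidHom.comp_apply, splitLift_splitClass, splitLift_leftInd_rightInd hT hU hX,
      AddMonoidHom.id_apply]
  · rw [AddMonoidHom.comp_apply, splitLift_splitClass, splitLift_rightInd_leftInd hT hU hY,
      AddMonoidHom.id_apply]
  · have e : splitLift (isAdditiveValue_rightInd hU T) (splitClass X hX) = rightInd hU X :=
      splitLift_splitClass _ X hX
    change S.IsRightIndex U 1 X (splitLift (isAdditiveValue_rightInd hU T) (splitClass X hX))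
    rw [e]
    exact isRightIndex_rightInd hU le_rfl (hU.nonempty_rightFiltration X)
  · have e : splitLift (isAdditiveValue_leftInd hT U) (splitClass Y hY) = leftInd hT Y :=
      splitLift_splitClass _ Y hY
    change S.IsLeftIndex T 1 Y (splitLift (isAdditiveValue_leftInd hT U) (splitClass Y hY))
    rw [e]
    exact isLeftIndex_leftInd hT le_rfl (nonempty_leftFiltration hT Y)

end TwoSubcategories

end ExtriangulatedStructure

end Extri

theorem theorem5p4 {C : Type u} [Category.{v} C] [Preadditive C] [HasZeroObject C]
    [HasBinaryBiproducts C] (S : Extri.ExtriangulatedStructure.{w} C) (d : ℕ) (hd : 1 ≤ d)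
    (T U : ObjectProperty C) (hT : S.IsClusterTilting (d + 1) T)
    (hU : S.IsClusterTilting (d + 1) U) :
    -- for `d = 1`, the right `U`-index and the left `T`-index are inverse isomorphisms
    (d = 1 → ∃ e : Extri.K0sp T ≃+ Extri.K0sp U,
      (∀ (X : C) (hX : T X),
        S.IsRightIndex U d X (e (Extri.splitClass X hX))) ∧
      (∀ (Y : C) (hY : U Y),
        S.IsLeftIndex T d Y (e.symm (Extri.splitClass Y hY)))) ∧
    -- `K₀(T^t) ≅ K₀^sp(T) ≅ K₀(T_t)` for `1 ≤ t < d`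
    (∀ t : ℕ, 1 ≤ t → t < d →
      (∃ e : S.K0rel S.allExt (S.upper T t) ≃+ Extri.K0sp T,
        ∀ (X : C) (hX : S.upper T t X), S.IsLeftIndex T t X (e (S.relClass S.allExt X hX))) ∧
      (∃ e : S.K0rel S.allExt (S.lower T t) ≃+ Extri.K0sp T,
        ∀ (X : C) (hX : S.lower T t X), S.IsRightIndex T t X (e (S.relClass S.allExt X hX)))) ∧
    -- `K₀(C) ≅ K₀^in(T)` by the left index and by the right index
    (S.imPhi T d = S.imPsi T d ∧
      (∃ e : S.K0rel S.allExt (⊤ : ObjectProperty C) ≃+ S.K0in T d, ∀ X : C,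
        ∃ g, S.IsLeftIndex T d X g ∧
          e (S.relClass S.allExt X trivial) = QuotientAddGroup.mk g) ∧
      (∃ e : S.K0rel S.allExt (⊤ : ObjectProperty C) ≃+ S.K0in T d, ∀ X : C,
        ∃ g, S.IsRightIndex T d X g ∧
          e (S.relClass S.allExt X trivial) = QuotientAddGroup.mk g)) ∧
    -- the relative Grothendieck groups of `E^T` and `E_T` are isomorphic to `K₀^sp(T)`
    ((∃ e : S.K0rel (S.upperExt T) (⊤ : ObjectProperty C) ≃+ Extri.K0sp T,
        (∀ X : C, S.IsLeftIndex T d X (e (S.relClass (S.upperExt T) X trivial))) ∧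
        (∀ (M : C) (hM : T M), e.symm (Extri.splitClass M hM) =
          S.relClass (S.upperExt T) M trivial)) ∧
      (∃ e : S.K0rel (S.lowerExt T) (⊤ : ObjectProperty C) ≃+ Extri.K0sp T,
        (∀ X : C, S.IsRightIndex T d X (e (S.relClass (S.lowerExt T) X trivial))) ∧
        (∀ (M : C) (hM : T M), e.symm (Extri.splitClass M hM) =
          S.relClass (S.lowerExt T) M trivial))) := by
  have hR := hT.isRightTilting
  have hL := hT.isRightTilting_op
  refine ⟨?_, fun t _ ht => ⟨?_, ?_⟩, ⟨?_, ?_, ?_⟩, ?_, ?_⟩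
  · rintro rfl
    exact Extri.ExtriangulatedStructure.exists_addEquiv_of_isRightTilting hL hU.isRightTilting
  · exact Extri.ExtriangulatedStructure.exists_addEquiv_upper hL ht
  · exact Extri.ExtriangulatedStructure.exists_addEquiv_lower hR ht
  · exact Extri.ExtriangulatedStructure.imPhi_eq_imPsi hR hL hd
  · obtain ⟨e, he⟩ := Extri.ExtriangulatedStructure.exists_addEquiv_K0in hR hL hd
    exact ⟨e, fun X => ⟨_, Extri.ExtriangulatedStructure.isLeftIndex_leftInd hL le_rfl
      (Extri.ExtriangulatedStructure.nonempty_leftFiltration hL X), (he X).1⟩⟩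
  · obtain ⟨e, he⟩ := Extri.ExtriangulatedStructure.exists_addEquiv_K0in hR hL hd
    exact ⟨e, fun X => ⟨_, Extri.ExtriangulatedStructure.isRightIndex_rightInd hR le_rfl
      (hR.nonempty_rightFiltration X), (he X).2⟩⟩
  · exact Extri.ExtriangulatedStructure.exists_addEquiv_upperExt hL
  · exact Extri.ExtriangulatedStructure.exists_addEquiv_lowerExt hR
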